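/- Let $K,N\ge 1$ and $T\ge 2$ be integers. A Bernoulli hierarchical causal bandit with $K$-valued context has parameters $\theta=(\boldsymbol\alpha,\{\mathbf p^{(i)}\}_{0\le i<K},r)$ with $\alpha_i>0$, $\sum_i\alpha_i=1$, $\mathbf p^{(i)}\in[0,1]^N$ and $r:\{0,1\}^N\to[0,1]$. Its variables are a context $S\in\{0,\dots,K-1\}$ with $P(S=i)=\alpha_i$, arms $X_1,\dots,X_N\in\{0,1\}$ that are independent given $S$ with $P(X_j=1\mid S=i)=p^{(i)}_j$, and a reward $Y\in\{0,1\}$ with $P(Y=1\mid \mathbf X=\mathbf x,S)=r(\mathbf x)$. The intervention $\mathsf{do}(Z=z)$ replaces the conditional law of $Z\in\{S,X_1,\dots,X_N\}$ in this factorization by the point mass at $z$; $\mathsf{do}(\varnothing)$ leaves the law unchanged. The set of actions is $\mathcal A^{\mathsf{nmc}}=\{\mathsf{do}(\varnothing)\}\cup\{\mathsf{do}(X_n=x):1\le n\le N,\ x\in\{0,1\}\}$ if the context is non-manipulable, and $\mathcal A^{\mathsf{mc}}=\mathcal A^{\mathsf{nmc}}\cup\{\mathsf{do}(S=s):0\le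 s<K\}$ if it is manipulable. An algorithm with action set $\mathcal A$ and horizon $T$ is a collection of functions $g^{(t)}$, $1\le t\le T+1$ (measurable in their last argument), which map the history of the first $t-1$ rounds (contexts, arm values, rewards and actions) and the value of a fresh independent uniform variable on $[0,1]$ to an action in $\mathcal A$. The functions $g^{(1)},\dots,g^{(T)}$ choose the actions of $T$ experiments, where the variables of each round are drawn, independently of the past given the chosen action, from the law under that action; $g^{(T+1)}$ outputs the recommended action $\hat A_T$. With $\mu_a=\mathbb E[Y\mid a]$, the simple regret is $R_T=\max_{a\in\mathcal A}\mu_a-\sum_{a\in\mathcal A}\mu_a P(\hat A_T=a)$. For $\mathbf v\in[0,1]^N$ let $$m(\mathbf v)=\min\Big\{s>0:\ s\ge\big|\{n:\min\{v_n,1-v_n\}<1/s\}\big|\Big\},\qquad \widetilde m=\sum_{i=0}^{K-1}\alpha_i\,m(\mathbf p^{(i)}).$$ There is an algorithm with action set $\mathcal A^{\mathsf{nmc}}$, depending only on $K,N,T$ and not on $\theta$, and there is an algorithm with action set $\mathcal A^{\mathsf{mc}}$, likewise depending only on $K,N,T$, such that for every $\theta$ with $$T>600(7K+1)\,\max_{0\le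 i<K}\Big\{\frac{m(\mathbf p^{(i)})}{\alpha_i}\Big\}\,\log(NT)$$ their simple regrets satisfy, respectively, $$R_T^{\mathsf{nmc}}\le 27\sqrt{\frac{K(2K+1)\,\widetilde m\,\log(NT)}{T}},\qquad R_T^{\mathsf{mc}}\le 7\sqrt{\frac{K(7K+1)\,\widetilde m\,\log(NT)}{T}}.$$ -/

import Mathlib

namespace HCB

/-- The interventions of a hierarchical causal bandit with `N` binary arms and a context with
values in `Fin K`: the empty one `do(∅)`, `do(X_n = x)`, and `do(S = s)`. -/
inductive Intervention (K N : ℕ) : Type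
  | empty : Intervention K N
  | arm (n : Fin N) (x : Bool) : Intervention K N
  | context (s : Fin K) : Intervention K N
  deriving DecidableEq

/-- Actions available when the context is not manipulable: `do(∅)` and all `do(X_n = x)`. -/
def nmcActions (K N : ℕ) : Finset (Intervention K N) :=
  {Intervention.empty} ∪
    Finset.univ.image (fun nx : Fin N × Bool => Intervention.arm nx.1 nx.2)

/-- Actions available when the context is manipulable: additionally all `do(S = s)`. -/
def mcActions (K N : ℕ) : Finset (Intervention K N) :=
  nmcActions K N ∪ Finset.univ.image (fun s : Fin K => Intervention.context s)

/-- Parameters `(α, p, r)` of a Bernoulli hierarchical causal bandit with a `K`-valued context: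
`α i = P(S = i)`, `p i j = P(X_j = 1 | S = i)` and `r x = P(Y = 1 | X = x)`. -/
structure Model (K N : ℕ) where
  α : Fin K → ℝ
  p : Fin K → Fin N → ℝ
  r : (Fin N → Bool) → ℝ
  α_pos : ∀ i, 0 < α i
  α_sum : ∑ i, α i = 1
  p_mem : ∀ i j, p i j ∈ Set.Icc (0 : ℝ) 1
  r_mem : ∀ x, r x ∈ Set.Icc (0 : ℝ) 1

/-- What is observed in one round: the values of `S`, of `X_1, …, X_N`, and of `Y`. -/
abbrev Obs (K N : ℕ) : Type := Fin K × (Fin N → Bool) × Bool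

/-- The mass at `b` of the Bernoulli distribution with `P(true) = q`. -/
def bern (q : ℝ) (b : Bool) : ℝ := if b then q else 1 - q

namespace Model

variable {K N : ℕ}

/-- The law of `S` under an intervention: a point mass under `do(S = s)`, and `α` otherwise. -/
def probS (θ : Model K N) (a : Intervention K N) (s : Fin K) : ℝ :=
  match a with
  | .context s' => if s = s' then 1 else 0
  | _ => θ.α s

/-- The conditional law of `X_n` given `S = s` under an intervention: a point mass under
`do(X_n = x')`, and the Bernoulli law with parameter `p s n` otherwise. -/
def probX (θ : Model K N) (a : Intervention K N) (s : Fin K) (n : Fin N) (x : Bool) : ℝ :=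
  match a with
  | .arm n' x' => if n = n' then (if x = x' then 1 else 0) else bern (θ.p s n) x
  | _ => bern (θ.p s n) x

/-- The joint law `P(S = s, X = x, Y = y | do(a))`, in factorized form. -/
def prob (θ : Model K N) (a : Intervention K N) (o : Obs K N) : ℝ :=
  θ.probS a o.1 * (∏ n, θ.probX a o.1 n (o.2.1 n)) * bern (θ.r o.2.1) o.2.2

/-- The expected reward `μ_a = E[Y | do(a)]`. -/
def mean (θ : Model K N) (a : Intervention K N) : ℝ :=
  ∑ o : Obs K N, θ.prob a o * (if o.2.2 then 1 else 0)

end Model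

/-- The histories of `t` rounds: what was observed and which action was played in each round. -/
abbrev History {K N : ℕ} (A : Finset (Intervention K N)) (t : ℕ) : Type :=
  Fin t → Obs K N × A

/-- A randomized algorithm with action set `A`. `rule t h w` is the action selected after the
`t`-round history `h`, with `w` the value of a fresh random variable, uniform on `[0,1]`.
With horizon `T`, the rules `0, …, T - 1` select the actions of the `T` experiments, the rule `T`
selects the recommended action, and later rules are not used. -/
structure Algorithm {K N : ℕ} (A : Finset (Intervention K N)) where
  rule : (t : ℕ) → History A t → unitInterval → A
  measurable_rule : ∀ t h a, MeasurableSet {w | rule t h w = a}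

namespace Algorithm

variable {K N : ℕ} {A : Finset (Intervention K N)}

/-- The conditional probability that the rule `t` selects `a`, given the history `h`. -/
noncomputable def select (φ : Algorithm A) (t : ℕ) (h : History A t) (a : A) : ℝ :=
  (MeasureTheory.volume {w : unitInterval | φ.rule t h w = a}).toReal

/-- The probability that the first `t` rounds of the algorithm `φ` in the model `θ` produce the
history `h`: the round `ℓ` selects its action given the previous rounds, and the observation is
then drawn from the law under that intervention. -/
noncomputable def histProb (φ : Algorithm A) (θ : Model K N) (t : ℕ) (h : History A t) : ℝ :=
  ∏ ℓ : Fin t, φ.select ℓ (fun j : Fin ℓ => h (Fin.castLE ℓ.isLt.le j)) (h ℓ).2 *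
    θ.prob (h ℓ).2 (h ℓ).1

/-- The probability that the action recommended after `T` rounds is `a`. -/
noncomputable def recommend (φ : Algorithm A) (θ : Model K N) (T : ℕ) (a : A) : ℝ :=
  ∑ h : History A T, φ.histProb θ T h * φ.select T h a

/-- The simple regret `R_T = max_a μ_a - ∑_a μ_a P(Â_T = a)`, over the available actions `A`. -/
noncomputable def regret (φ : Algorithm A) (θ : Model K N) (T : ℕ) : ℝ :=
  (⨆ a : A, θ.mean a) - ∑ a : A, θ.mean a * φ.recommend θ T a

end Algorithm

/-- The entries of `v` that are biased beyond `1 / s`. -/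
noncomputable def biased {N : ℕ} (v : Fin N → ℝ) (s : ℝ) : Finset (Fin N) :=
  Finset.univ.filter (fun n => min (v n) (1 - v n) < 1 / s)

/-- The least positive real `s` with `s ≥ |biased v s|`; see `m_isLeast`. -/
noncomputable def m {N : ℕ} (v : Fin N → ℝ) : ℝ :=
  sInf {s : ℝ | 0 < s ∧ ((biased v s).card : ℝ) ≤ s}

/-- The infimum in the definition of `m` is a minimum. -/
theorem m_isLeast {N : ℕ} (hN : 1 ≤ N) (v : Fin N → ℝ) :
    IsLeast {s : ℝ | 0 < s ∧ ((biased v s).card : ℝ) ≤ s} (m v) := by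
  have hN' : (1 : ℝ) ≤ N := by exact_mod_cast hN
  have hne : {s : ℝ | 0 < s ∧ ((biased v s).card : ℝ) ≤ s}.Nonempty := by
    refine ⟨N, by linarith, ?_⟩
    have := Finset.card_le_univ (biased v N)
    rw [Fintype.card_fin] at this
    exact_mod_cast this
  have hge : ∀ s ∈ {s : ℝ | 0 < s ∧ ((biased v s).card : ℝ) ≤ s}, 1 ≤ s := by
    rintro s ⟨h0, hs⟩
    by_contra! h
    have h1 : 1 < 1 / s := by rw [lt_div_iff₀ h0]; linarith
    have : biased v s = Finset.univ := by
      refine Finset.filter_true_of_mem fun n _ => ?_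
      rcases le_total (v n) 1 with hv | hv
      · exact (min_le_left _ _).trans_lt (by linarith)
      · exact (min_le_right _ _).trans_lt (by linarith)
    rw [this, Finset.card_univ, Fintype.card_fin] at hs
    linarith
  have hbdd : BddBelow {s : ℝ | 0 < s ∧ ((biased v s).card : ℝ) ≤ s} := ⟨1, hge⟩
  have h1 : 1 ≤ m v := le_csInf hne hge
  have h0 : 0 < m v := by linarith
  refine ⟨⟨h0, ?_⟩, fun s hs => csInf_le hbdd hs⟩
  by_contra! hlt
  have hc : ∀ᶠ s in nhds (m v), biased v (m v) ⊆ biased v s := by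
    have : ∀ n ∈ biased v (m v), ∀ᶠ s in nhds (m v), n ∈ biased v s := by
      intro n hn
      have hn' : min (v n) (1 - v n) < 1 / m v := (Finset.mem_filter.1 hn).2
      have hcont : ContinuousAt (fun s : ℝ => 1 / s) (m v) :=
        continuousAt_const.div continuousAt_id h0.ne'
      filter_upwards [hcont.eventually_const_lt hn'] with s hs
      exact Finset.mem_filter.2 ⟨Finset.mem_univ _, hs⟩
    filter_upwards [(Filter.eventually_all_finset _).2 this] with s hs n hn using hs n hn
  obtain ⟨ε, hε, hball⟩ := Metric.eventually_nhds_iff.1 (hc.and (eventually_lt_nhds hlt))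
  obtain ⟨s, hs, hsε⟩ := exists_lt_of_csInf_lt hne (show m v < m v + ε by linarith)
  have hms : m v ≤ s := csInf_le hbdd hs
  obtain ⟨hsub, hs2⟩ := hball (y := s) (by rw [Real.dist_eq, abs_lt]; constructor <;> linarith)
  have h3 : ((biased v (m v)).card : ℝ) ≤ (biased v s).card := by
    exact_mod_cast Finset.card_le_card hsub
  linarith [hs.2]

/-- The average difficulty `∑ i, α i * m (p i)` of the contexts. -/
noncomputable def Model.mAvg {K N : ℕ} (θ : Model K N) : ℝ := ∑ i, θ.α i * m (θ.p i)

/-- The number `T` of experiments is large enough for the model `θ`. The index set is finite, so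
for `1 ≤ K` the supremum is a maximum. -/
def Model.LargeHorizon {K N : ℕ} (θ : Model K N) (T : ℕ) : Prop :=
  (T : ℝ) > 600 * (7 * (K : ℝ) + 1) * (⨆ i, m (θ.p i) / θ.α i) * Real.log ((N : ℝ) * T)

end HCB

/-! A single deterministic strategy serves both action sets, with `do(∅)` in place of any scheduled
action that is unavailable. It only observes during half of the horizon. For a quarter it then
cycles through the contexts `i` and the arm values that the observations show to be rare in context
`i`. The remaining rounds set the contexts in turn, and the recommendation maximizes the estimated
mean.

The mean of `do(X_n = x)` is estimated context by context and averaged with the empirical law of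
`S`. Given `S = i` the arms are independent, so rewards seen with `X_n = x` under `do(∅)` and under
`do(X_n = x)` have the same mean and can be pooled (`sum_prob_sub_armMean`). A value that is not
rare occurs in a share at least `1 / m(p̂ᵢ)` of the observed rounds with `S = i`. At most `2 m(p̂ᵢ)`
values are rare, so each is played in order `T / (K m(p̂ᵢ))` rounds, of which a share about `αᵢ` has
`S = i`. Since `m(p̂ᵢ) ≤ 5 m(pᵢ)` on typical histories (`m_pHat_le`), every estimate rests on at
least `αᵢ T / (100 K m(pᵢ))` rounds (`minVisits_le`). The resulting errors, weighted by `αᵢ`, add up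
by Cauchy–Schwarz to order `K √(m̃ L / T)` with `L = log (N T)` (`sum_mul_sqrt_le`), and the other
errors are of no larger order.

The rounds that count for an estimate depend on the past, so concentration comes from products of
factors of conditional mean at most one (`sum_histProb_mul_prod_le`). These give a Hoeffding bound
for a random number of samples and multiplicative bounds for counts. A union bound leaves atypical
histories with probability at most `16 K / T` (`histProbOf_atypical_le`). -/

namespace HCB

/-! ### Moments of one round. -/

namespace Model

variable {K N : ℕ} (θ : Model K N)

theorem bern_nonneg {q : ℝ} (hq : q ∈ Set.Icc (0 : ℝ) 1) (b : Bool) : 0 ≤ bern q b := by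
  obtain ⟨h0, h1⟩ := hq
  cases b <;> simp [bern, h0, h1]

theorem sum_bern (q : ℝ) : ∑ b, bern q b = 1 := by simp [bern]

theorem probS_nonneg (a : Intervention K N) (s : Fin K) : 0 ≤ θ.probS a s := by
  have := (θ.α_pos s).le
  cases a <;> simp only [probS] <;> first | assumption | (split_ifs <;> norm_num)

theorem sum_probS (a : Intervention K N) : ∑ s, θ.probS a s = 1 := by
  cases a <;> simp [probS, θ.α_sum]

theorem probX_nonneg (a : Intervention K N) (s : Fin K) (n : Fin N) (x : Bool) :
    0 ≤ θ.probX a s n x := by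
  have := bern_nonneg (θ.p_mem s n) x
  cases a <;> simp only [probX] <;> first | assumption | (split_ifs <;> first | assumption | norm_num)

theorem sum_probX (a : Intervention K N) (s : Fin K) (n : Fin N) :
    ∑ x, θ.probX a s n x = 1 := by
  cases a <;> simp only [probX, sum_bern]
  split_ifs
  · simp
  · exact sum_bern _

theorem sum_prod_probX (a : Intervention K N) (s : Fin K) :
    ∑ x : Fin N → Bool, ∏ n, θ.probX a s n (x n) = 1 := by
  rw [← Fintype.piFinset_univ, ← Finset.prod_univ_sum (fun _ => Finset.univ) (θ.probX a s)]
  exact Finset.prod_eq_one fun n _ => θ.sum_probX a s n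

theorem prob_nonneg (a : Intervention K N) (o : Obs K N) : 0 ≤ θ.prob a o :=
  mul_nonneg (mul_nonneg (θ.probS_nonneg a _) (Finset.prod_nonneg fun n _ => θ.probX_nonneg a _ n _))
    (bern_nonneg (θ.r_mem _) _)

/-- Expectation of a function of the context and the arms. -/
theorem sum_prob_mul (a : Intervention K N) (F : Fin K → (Fin N → Bool) → ℝ) :
    ∑ o : Obs K N, θ.prob a o * F o.1 o.2.1 =
      ∑ s, θ.probS a s * ∑ x : Fin N → Bool, (∏ n, θ.probX a s n (x n)) * F s x := by
  simp only [Fintype.sum_prod_type, prob, Finset.mul_sum]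
  refine Finset.sum_congr rfl fun s _ => Finset.sum_congr rfl fun x _ => ?_
  rw [← Finset.sum_mul, ← Finset.mul_sum, sum_bern]
  ring

/-- Expectation of the reward times a function of the context and the arms. -/
theorem sum_prob_mul_reward (a : Intervention K N) (F : Fin K → (Fin N → Bool) → ℝ) :
    ∑ o : Obs K N, θ.prob a o * (F o.1 o.2.1 * (if o.2.2 then 1 else 0)) =
      ∑ s, θ.probS a s * ∑ x : Fin N → Bool, (∏ n, θ.probX a s n (x n)) * (F s x * θ.r x) := by
  simp only [Fintype.sum_prod_type, prob, Finset.mul_sum]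
  refine Finset.sum_congr rfl fun s _ => Finset.sum_congr rfl fun x _ => ?_
  simp [bern]
  ring

theorem sum_prob (a : Intervention K N) : ∑ o, θ.prob a o = 1 := by
  have := θ.sum_prob_mul a fun _ _ => 1
  simpa [sum_prod_probX, sum_probS] using this

theorem mean_mem (a : Intervention K N) : θ.mean a ∈ Set.Icc (0 : ℝ) 1 := by
  constructor
  · exact Finset.sum_nonneg fun o _ => mul_nonneg (θ.prob_nonneg a o) (by split_ifs <;> norm_num)
  · rw [← θ.sum_prob a]
    refine Finset.sum_le_sum fun o _ => mul_le_of_le_one_right (θ.prob_nonneg a o) ?_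
    split_ifs <;> norm_num

/-- The expected reward under `do(X_n = x)` in the context `i`. -/
def armMean (i : Fin K) (n : Fin N) (x : Bool) : ℝ :=
  ∑ z : Fin N → Bool, (∏ j, θ.probX (.arm n x) i j (z j)) * θ.r z

theorem armMean_mem (i : Fin K) (n : Fin N) (x : Bool) :
    θ.armMean i n x ∈ Set.Icc (0 : ℝ) 1 := by
  have h0 (z : Fin N → Bool) : 0 ≤ ∏ j, θ.probX (.arm n x) i j (z j) :=
    Finset.prod_nonneg fun j _ => θ.probX_nonneg _ _ j _
  constructor
  · exact Finset.sum_nonneg fun z _ => mul_nonneg (h0 z) (θ.r_mem z).1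
  · rw [← θ.sum_prod_probX (.arm n x) i]
    exact Finset.sum_le_sum fun z _ => mul_le_of_le_one_right (h0 z) (θ.r_mem z).2

theorem mean_arm (n : Fin N) (x : Bool) :
    θ.mean (.arm n x) = ∑ i, θ.α i * θ.armMean i n x := by
  have := θ.sum_prob_mul_reward (.arm n x) fun _ _ => 1
  simpa [mean, armMean, probS] using this

theorem prod_probX_arm_of_ne {n : Fin N} {x : Bool} {z : Fin N → Bool} (i : Fin K)
    (h : z n ≠ x) : ∏ j, θ.probX (.arm n x) i j (z j) = 0 :=
  Finset.prod_eq_zero (Finset.mem_univ n) (by simp [probX, h])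

/-- Conditional independence of the arms: within a context, intervening on `X_n` and conditioning on
its value differ only by the factor of `X_n`. -/
theorem prod_probX_empty {n : Fin N} {x : Bool} {z : Fin N → Bool} (i : Fin K) (h : z n = x) :
    ∏ j, θ.probX .empty i j (z j) =
      bern (θ.p i n) x * ∏ j, θ.probX (.arm n x) i j (z j) := by
  rw [← Finset.mul_prod_erase _ _ (Finset.mem_univ n),
    ← Finset.mul_prod_erase _ (fun j => θ.probX (.arm n x) i j (z j)) (Finset.mem_univ n)]
  simp only [probX, h, if_true, one_mul]
  congr 1
  refine Finset.prod_congr rfl fun j hj => ?_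
  rw [if_neg (Finset.ne_of_mem_erase hj)]

theorem sum_empty_restrict (i : Fin K) (n : Fin N) (x : Bool) (F : (Fin N → Bool) → ℝ) :
    ∑ z : Fin N → Bool, (∏ j, θ.probX .empty i j (z j)) * (if z n = x then F z else 0) =
      bern (θ.p i n) x * ∑ z : Fin N → Bool, (∏ j, θ.probX (.arm n x) i j (z j)) * F z := by
  rw [Finset.mul_sum]
  refine Finset.sum_congr rfl fun z _ => ?_
  by_cases h : z n = x
  · rw [if_pos h, θ.prod_probX_empty i h, mul_assoc]
  · rw [if_neg h, θ.prod_probX_arm_of_ne i h]; simp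

theorem sum_arm_restrict (i : Fin K) (n : Fin N) (x : Bool) (F : (Fin N → Bool) → ℝ) :
    ∑ z : Fin N → Bool, (∏ j, θ.probX (.arm n x) i j (z j)) * (if z n = x then F z else 0) =
      ∑ z : Fin N → Bool, (∏ j, θ.probX (.arm n x) i j (z j)) * F z := by
  refine Finset.sum_congr rfl fun z _ => ?_
  by_cases h : z n = x
  · rw [if_pos h]
  · rw [θ.prod_probX_arm_of_ne i h]; simp

/-- Given `S = i` and `X_n = x`, the rewards observed under `do(∅)` and under `do(X_n = x)` both
have the mean `armMean i n x`. -/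
theorem sum_prob_sub_armMean {a : Intervention K N} {n : Fin N} {x : Bool}
    (ha : a = .empty ∨ a = .arm n x) (i : Fin K) :
    ∑ o : Obs K N, θ.prob a o * (if o.1 = i ∧ o.2.1 n = x then
      (if o.2.2 then 1 else 0) - θ.armMean i n x else 0) = 0 := by
  have h1 := θ.sum_prob_mul_reward a fun s z => if s = i then if z n = x then 1 else 0 else 0
  have h2 := θ.sum_prob_mul a fun s z => if s = i then if z n = x then θ.armMean i n x else 0 else 0
  have h3 : ∀ o : Obs K N, θ.prob a o * (if o.1 = i ∧ o.2.1 n = x then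
      (if o.2.2 then 1 else 0) - θ.armMean i n x else 0) =
      θ.prob a o * ((if o.1 = i then if o.2.1 n = x then 1 else 0 else 0) *
        (if o.2.2 then 1 else 0)) -
      θ.prob a o * (if o.1 = i then if o.2.1 n = x then θ.armMean i n x else 0 else 0) := by
    intro o
    by_cases h : o.1 = i <;> by_cases h' : o.2.1 n = x <;> simp [h, h', mul_sub]
  rw [Finset.sum_congr rfl fun o _ => h3 o, Finset.sum_sub_distrib, h1, h2, sub_eq_zero]
  refine Finset.sum_congr rfl fun s _ => ?_
  congr 1
  by_cases h : s = i
  · subst h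
    simp only [if_true, ite_mul, one_mul, zero_mul]
    rcases ha with rfl | rfl
    · rw [θ.sum_empty_restrict, θ.sum_empty_restrict, ← Finset.sum_mul, sum_prod_probX, one_mul,
        armMean]
    · rw [θ.sum_arm_restrict, θ.sum_arm_restrict, ← Finset.sum_mul, sum_prod_probX, one_mul,
        armMean]
  · simp [h]

theorem sum_prob_context (a : Intervention K N) (i : Fin K) :
    ∑ o : Obs K N, θ.prob a o * (if o.1 = i then 1 else 0) = θ.probS a i := by
  have := θ.sum_prob_mul a fun s _ => if s = i then 1 else 0
  rw [this]
  simp [sum_prod_probX]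

theorem sum_prob_context_arm (i : Fin K) (n : Fin N) (x : Bool) :
    ∑ o : Obs K N, θ.prob .empty o * (if o.1 = i ∧ o.2.1 n = x then 1 else 0) =
      θ.α i * bern (θ.p i n) x := by
  have := θ.sum_prob_mul .empty fun s z => if z n = x then if s = i then 1 else 0 else 0
  have h2 (o : Obs K N) : (if o.1 = i ∧ o.2.1 n = x then (1 : ℝ) else 0) =
      if o.2.1 n = x then if o.1 = i then 1 else 0 else 0 := by
    by_cases h : o.1 = i <;> by_cases h' : o.2.1 n = x <;> simp [h, h']
  simp only [h2, this, θ.sum_empty_restrict, ← Finset.sum_mul, sum_prod_probX, probS]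
  simp

theorem sum_prob_sub_mean (a : Intervention K N) :
    ∑ o : Obs K N, θ.prob a o * ((if o.2.2 then 1 else 0) - θ.mean a) = 0 := by
  simp only [mul_sub, Finset.sum_sub_distrib, ← Finset.sum_mul, sum_prob]
  simp [mean]

theorem sum_prob_context_sub (a : Intervention K N) (i : Fin K) :
    ∑ o : Obs K N, θ.prob a o * ((if o.1 = i then 1 else 0) - θ.probS a i) = 0 := by
  simp only [mul_sub, Finset.sum_sub_distrib, ← Finset.sum_mul, sum_prob, sum_prob_context]
  simp

end Model

/-! ### The law of histories and exponential supermartingales. -/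

namespace Algorithm

variable {K N : ℕ} {A : Finset (Intervention K N)} (φ : Algorithm A) (θ : Model K N)

theorem select_nonneg (t : ℕ) (h : History A t) (a : A) : 0 ≤ φ.select t h a :=
  ENNReal.toReal_nonneg

theorem sum_select (t : ℕ) (h : History A t) : ∑ a, φ.select t h a = 1 := by
  have := MeasureTheory.sum_measure_preimage_singleton (μ := MeasureTheory.volume)
    (Finset.univ : Finset A) (f := φ.rule t h) fun a _ => φ.measurable_rule t h a
  simp only [select]
  rw [← ENNReal.toReal_sum fun a _ => MeasureTheory.measure_ne_top _ _]
  simp only [Set.preimage, Set.mem_singleton_iff] at this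
  rw [this]
  simp

theorem histProb_nonneg (t : ℕ) (h : History A t) : 0 ≤ φ.histProb θ t h :=
  Finset.prod_nonneg fun _ _ => mul_nonneg (φ.select_nonneg _ _ _) (θ.prob_nonneg _ _)

theorem histProb_snoc (t : ℕ) (h : History A t) (e : Obs K N × A) :
    φ.histProb θ (t + 1) (Fin.snoc h e) =
      φ.histProb θ t h * (φ.select t h e.2 * θ.prob e.2 e.1) := by
  simp only [histProb, Fin.prod_univ_castSucc, Fin.snoc_last, Fin.snoc_castSucc]
  have key (ℓ : ℕ) (hℓ : ℓ ≤ t) (hℓ' : ℓ ≤ t + 1) :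
      (fun j : Fin ℓ => (Fin.snoc h e : History A (t + 1)) (Fin.castLE hℓ' j)) =
        fun j => h (Fin.castLE hℓ j) := by
    funext j
    exact Fin.snoc_castSucc (α := fun _ => Obs K N × A) e h (Fin.castLE hℓ j)
  congr 1
  · refine Finset.prod_congr rfl fun ℓ _ => ?_
    congr 2
    exact key ℓ ℓ.isLt.le _
  · congr 2
    exact key t le_rfl _

/-- Conditioning on the first `t` rounds; every induction on the number of rounds goes through this
identity. -/
theorem sum_histProb_succ (t : ℕ) (F : History A (t + 1) → ℝ) :
    ∑ h, φ.histProb θ (t + 1) h * F h =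
      ∑ h, φ.histProb θ t h * ∑ a, φ.select t h a * ∑ o, θ.prob a o * F (Fin.snoc h (o, a)) := by
  rw [← (Fin.snocEquiv fun _ : Fin (t + 1) => Obs K N × A).sum_comp, Fintype.sum_prod_type_right]
  refine Finset.sum_congr rfl fun h _ => ?_
  rw [Fintype.sum_prod_type_right, Finset.mul_sum]
  refine Finset.sum_congr rfl fun a _ => ?_
  rw [Finset.mul_sum, Finset.mul_sum]
  refine Finset.sum_congr rfl fun o _ => ?_
  have := φ.histProb_snoc θ t h (o, a)
  simp only [Fin.snocEquiv, Equiv.coe_fn_mk, this]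
  ring

theorem sum_histProb (t : ℕ) : ∑ h, φ.histProb θ t h = 1 := by
  induction t with
  | zero => simp [histProb]
  | succ t ih =>
    have := φ.sum_histProb_succ θ t fun _ => 1
    simpa only [Model.sum_prob, sum_select, ih, mul_one] using this

/-- A product of factors of conditional mean at most one has mean at most one. -/
theorem sum_histProb_mul_prod_le (f : ℕ → Obs K N × A → ℝ) (hf0 : ∀ ℓ e, 0 ≤ f ℓ e)
    (hf : ∀ ℓ (a : A), ∑ o, θ.prob a o * f ℓ (o, a) ≤ 1) (t : ℕ) :
    ∑ h : History A t, φ.histProb θ t h * ∏ ℓ : Fin t, f ℓ (h ℓ) ≤ 1 := by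
  induction t with
  | zero => simp [histProb]
  | succ t ih =>
    rw [sum_histProb_succ]
    refine le_trans (Finset.sum_le_sum fun h _ => ?_) ih
    refine mul_le_mul_of_nonneg_left ?_ (φ.histProb_nonneg θ t h)
    have h0 : 0 ≤ ∏ ℓ : Fin t, f ℓ (h ℓ) := Finset.prod_nonneg fun _ _ => hf0 _ _
    calc _ ≤ ∑ a, φ.select t h a * ∏ ℓ : Fin t, f ℓ (h ℓ) := by
          refine Finset.sum_le_sum fun a _ =>
            mul_le_mul_of_nonneg_left ?_ (φ.select_nonneg t h a)
          simp only [Fin.prod_univ_castSucc, Fin.snoc_last, Fin.snoc_castSucc, Fin.val_castSucc,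
            Fin.val_last]
          calc _ = (∏ ℓ : Fin t, f ℓ (h ℓ)) * ∑ o, θ.prob a o * f t (o, a) := by
                rw [Finset.mul_sum]
                exact Finset.sum_congr rfl fun o _ => by ring
            _ ≤ _ := mul_le_of_le_one_right h0 (hf t a)
      _ = _ := by rw [← Finset.sum_mul, sum_select, one_mul]

open Classical in
/-- The probability that the history of the first `t` rounds satisfies `P`. -/
noncomputable def histProbOf (t : ℕ) (P : History A t → Prop) : ℝ :=
  ∑ h, φ.histProb θ t h * if P h then 1 else 0

variable {φ θ}

theorem histProbOf_mono {t : ℕ} {P Q : History A t → Prop} (h : ∀ x, P x → Q x) :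
    φ.histProbOf θ t P ≤ φ.histProbOf θ t Q := by
  classical
  refine Finset.sum_le_sum fun x _ => mul_le_mul_of_nonneg_left ?_ (φ.histProb_nonneg θ t x)
  by_cases hP : P x
  · simp [hP, h x hP]
  · rw [if_neg hP]; split_ifs <;> norm_num

theorem histProbOf_or_le {t : ℕ} {P Q : History A t → Prop} {c d : ℝ}
    (hP : φ.histProbOf θ t P ≤ c) (hQ : φ.histProbOf θ t Q ≤ d) :
    φ.histProbOf θ t (fun h => P h ∨ Q h) ≤ c + d := by
  classical
  refine le_trans ?_ (add_le_add hP hQ)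
  rw [histProbOf, histProbOf, histProbOf, ← Finset.sum_add_distrib]
  refine Finset.sum_le_sum fun x _ => ?_
  rw [← mul_add]
  refine mul_le_mul_of_nonneg_left ?_ (φ.histProb_nonneg θ t x)
  by_cases hP : P x <;> by_cases hQ : Q x <;> simp [hP, hQ]

theorem histProbOf_exists_le {ι : Type*} [Fintype ι] {t : ℕ} {P : ι → History A t → Prop} {c : ℝ}
    (hP : ∀ k, φ.histProbOf θ t (P k) ≤ c) :
    φ.histProbOf θ t (fun h => ∃ k, P k h) ≤ Fintype.card ι * c := by
  classical
  calc _ ≤ ∑ k, φ.histProbOf θ t (P k) := by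
        simp only [histProbOf]
        rw [Finset.sum_comm]
        refine Finset.sum_le_sum fun x _ => ?_
        rw [← Finset.mul_sum]
        refine mul_le_mul_of_nonneg_left ?_ (φ.histProb_nonneg θ t x)
        split_ifs with h
        · obtain ⟨k, hk⟩ := h
          refine le_trans ?_ (Finset.single_le_sum (f := fun k => if P k x then (1 : ℝ) else 0)
            (fun k _ => by split_ifs <;> norm_num) (Finset.mem_univ k))
          simp [hk]
        · exact Finset.sum_nonneg fun k _ => by split_ifs <;> norm_num
    _ ≤ ∑ _k : ι, c := Finset.sum_le_sum fun k _ => hP k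
    _ = _ := by simp

/-- Markov's inequality for the exponential of the sum: the indicator of the event is at most `exp
(∑ g - L)`. -/
theorem histProbOf_le_exp {t : ℕ} {g : ℕ → Obs K N × A → ℝ}
    (hg : ∀ ℓ (a : A), ∑ o, θ.prob a o * Real.exp (g ℓ (o, a)) ≤ 1) (L : ℝ) :
    φ.histProbOf θ t (fun h => L ≤ ∑ ℓ : Fin t, g ℓ (h ℓ)) ≤ Real.exp (-L) := by
  classical
  have := φ.sum_histProb_mul_prod_le θ (fun ℓ e => Real.exp (g ℓ e)) (fun _ _ => (Real.exp_pos _).le)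
    hg t
  calc _ ≤ ∑ h : History A t,
          φ.histProb θ t h * (∏ ℓ : Fin t, Real.exp (g ℓ (h ℓ))) * Real.exp (-L) := by
        refine Finset.sum_le_sum fun h _ => ?_
        rw [mul_assoc]
        refine mul_le_mul_of_nonneg_left ?_ (φ.histProb_nonneg θ t h)
        rw [← Real.exp_sum, ← Real.exp_add]
        split_ifs with hL
        · exact Real.one_le_exp (by linarith)
        · exact (Real.exp_pos _).le
    _ ≤ _ := by
        rw [← Finset.sum_mul]
        exact mul_le_of_le_one_left (Real.exp_pos _).le this

end Algorithm

/-- Hoeffding's lemma for a Bernoulli variable. -/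
theorem bernoulli_mgf_le {μ : ℝ} (hμ : μ ∈ Set.Icc (0 : ℝ) 1) (c : ℝ) :
    μ * Real.exp (c * (1 - μ)) + (1 - μ) * Real.exp (-(c * μ)) ≤ Real.exp (c ^ 2 / 8) := by
  have h01 : ∀ᵐ x ∂ProbabilityTheory.bernoulliMeasure (1 : ℝ) 0 ⟨μ, hμ⟩, x ∈ Set.Icc (0 : ℝ) 1 := by
    rw [MeasureTheory.ae_iff]
    exact ProbabilityTheory.bernoulliMeasure_apply_of_notMem_of_notMem _
      measurableSet_Icc.compl (by simp) (by simp)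
  -- A variable with values in an interval of length one has variance proxy `1 / 4`, hence the
  -- exponent `c ^ 2 / 8`.
  have h := (ProbabilityTheory.hasSubgaussianMGF_of_mem_Icc (X := fun x : ℝ => x)
    measurable_id.aemeasurable h01).mgf_le c
  simp only [ProbabilityTheory.mgf, ProbabilityTheory.integral_bernoulliMeasure] at h
  simp only [smul_eq_mul, mul_one, mul_zero, add_zero, zero_sub, mul_neg] at h
  refine h.trans_eq ?_
  congr 1
  simp
  ring

/-! ### Concentration of frequencies and counts over randomly many rounds. -/

namespace Algorithm

variable {K N : ℕ} {A : Finset (Intervention K N)} {φ : Algorithm A} {θ : Model K N}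

open Classical in
/-- The number of rounds `ℓ` of a history in which `V ℓ` holds. -/
noncomputable def visits {t : ℕ} (V : ℕ → Obs K N × A → Prop) (h : History A t) : ℝ :=
  ∑ ℓ : Fin t, if V ℓ (h ℓ) then 1 else 0

open Classical in
/-- The frequency of `y` in the rounds `ℓ` of a history in which `V ℓ` holds. -/
noncomputable def freq {t : ℕ} (V : ℕ → Obs K N × A → Prop) (y : Obs K N → Bool)
    (h : History A t) : ℝ :=
  (∑ ℓ : Fin t, if V ℓ (h ℓ) then (if y (h ℓ).1 then 1 else 0) else 0) / visits V h

theorem visits_nonneg {t : ℕ} (V : ℕ → Obs K N × A → Prop) (h : History A t) : 0 ≤ visits V h :=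
  Finset.sum_nonneg fun _ _ => by split_ifs <;> norm_num

/-- No visit is required: the quotient by zero visits is `0`. -/
theorem freq_mem {t : ℕ} (V : ℕ → Obs K N × A → Prop) (y : Obs K N → Bool) (h : History A t) :
    freq V y h ∈ Set.Icc (0 : ℝ) 1 := by
  constructor
  · exact div_nonneg (Finset.sum_nonneg fun _ _ => by split_ifs <;> norm_num) (visits_nonneg V h)
  · refine div_le_one_of_le₀ (Finset.sum_le_sum fun ℓ _ => ?_) (visits_nonneg V h)
    split_ifs <;> norm_num

theorem visits_mono {t : ℕ} {V W : ℕ → Obs K N × A → Prop} {h : History A t}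
    (hVW : ∀ ℓ : Fin t, V ℓ (h ℓ) → W ℓ (h ℓ)) : visits V h ≤ visits W h := by
  refine Finset.sum_le_sum fun ℓ _ => ?_
  by_cases hV : V ℓ (h ℓ)
  · simp [hV, hVW ℓ hV]
  · rw [if_neg hV]; split_ifs <;> norm_num

theorem card_le_visits {t : ℕ} {V : ℕ → Obs K N × A → Prop} {h : History A t} {k : ℕ}
    (f : ℕ → ℕ) (hf : Set.InjOn f (Set.Iio k)) (hlt : ∀ l < k, f l < t)
    (hV : ∀ l < k, ∀ hl : f l < t, V (f l) (h ⟨f l, hl⟩)) : (k : ℝ) ≤ visits V h := by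
  classical
  rw [visits, Finset.sum_boole]
  have := Finset.card_le_card_of_injOn (s := (Finset.univ : Finset (Fin k)))
    (t := Finset.univ.filter fun ℓ : Fin t => V ℓ (h ℓ)) (fun l => ⟨f l, hlt l l.isLt⟩)
    (fun l _ => by simpa using hV l l.isLt (hlt l l.isLt))
    (fun l _ l' _ hl => Fin.ext (hf l.isLt l'.isLt (by simpa using hl)))
  rw [Finset.card_univ, Fintype.card_fin] at this
  exact_mod_cast this

open Classical in
-- A function of a binary `y` is affine in `y`. On `V` the exponential is thus a value at `μ`, at
-- most `1` by Hoeffding's lemma, plus a slope `B` times `y - μ`, whose mean over `V` vanishes.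
theorem sum_prob_exp_le {a : Intervention K N} {V : Obs K N → Prop} {y : Obs K N → Bool} {μ : ℝ}
    (hμ : μ ∈ Set.Icc (0 : ℝ) 1)
    (hV : ∑ o, θ.prob a o * (if V o then (if y o then 1 else 0) - μ else 0) = 0) (c : ℝ) :
    ∑ o, θ.prob a o *
      Real.exp (if V o then c * ((if y o then 1 else 0) - μ) - c ^ 2 / 8 else 0) ≤ 1 := by
  set B : ℝ := Real.exp (-(c ^ 2 / 8)) * (Real.exp (c * (1 - μ)) - Real.exp (-(c * μ))) with hB
  have key : Real.exp (-(c ^ 2 / 8)) *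
      (μ * Real.exp (c * (1 - μ)) + (1 - μ) * Real.exp (-(c * μ))) ≤ 1 := by
    refine (mul_le_mul_of_nonneg_left (bernoulli_mgf_le hμ c) (Real.exp_pos _).le).trans_eq ?_
    rw [← Real.exp_add]; simp
  have hpt (o : Obs K N) :
      Real.exp (if V o then c * ((if y o then 1 else 0) - μ) - c ^ 2 / 8 else 0) ≤
        1 + B * (if V o then (if y o then 1 else 0) - μ else 0) := by
    by_cases hv : V o
    · simp only [hv, if_true]
      cases y o
      · have : c * ((if false = true then (1 : ℝ) else 0) - μ) - c ^ 2 / 8 =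
            -(c ^ 2 / 8) + -(c * μ) := by simp; ring
        rw [this, Real.exp_add, hB]
        simp only [Bool.false_eq_true, if_false]
        nlinarith [key]
      · have : c * ((if true = true then (1 : ℝ) else 0) - μ) - c ^ 2 / 8 =
            -(c ^ 2 / 8) + c * (1 - μ) := by simp; ring
        rw [this, Real.exp_add, hB]
        simp only [if_true]
        nlinarith [key]
    · simp [hv]
  calc _ ≤ ∑ o, θ.prob a o * (1 + B * (if V o then (if y o then 1 else 0) - μ else 0)) :=
        Finset.sum_le_sum fun o _ => mul_le_mul_of_nonneg_left (hpt o) (θ.prob_nonneg a o)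
    _ = ∑ o, θ.prob a o +
          B * ∑ o, θ.prob a o * (if V o then (if y o then 1 else 0) - μ else 0) := by
        rw [Finset.mul_sum, ← Finset.sum_add_distrib]
        exact Finset.sum_congr rfl fun o _ => by ring
    _ ≤ 1 := by rw [hV, θ.sum_prob]; simp

open Classical in
theorem sum_sub_eq_freq {t : ℕ} {V : ℕ → Obs K N × A → Prop} {y : Obs K N → Bool} (μ c d : ℝ)
    (h : History A t) (hC : 0 < visits V h) :
    ∑ ℓ : Fin t, (if V ℓ (h ℓ) then c * ((if y (h ℓ).1 then 1 else 0) - μ) - d else 0) =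
      (c * (freq V y h - μ) - d) * visits V h := by
  have h1 : freq V y h * visits V h =
      ∑ ℓ : Fin t, if V ℓ (h ℓ) then (if y (h ℓ).1 then 1 else 0) else 0 :=
    div_mul_cancel₀ _ hC.ne'
  have : (c * (freq V y h - μ) - d) * visits V h =
      c * (freq V y h * visits V h) - (c * μ + d) * visits V h := by ring
  rw [this, h1, visits, Finset.mul_sum, Finset.mul_sum, ← Finset.sum_sub_distrib]
  refine Finset.sum_congr rfl fun ℓ _ => ?_
  by_cases hV : V ℓ (h ℓ) <;> simp only [hV, if_true, if_false] <;> ring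

/-- The frequency of `y` in at least `n₀` rounds deviates from `μ`. -/
def Deviates (V : ℕ → Obs K N × A → Prop) (y : Obs K N → Bool) (μ n₀ L : ℝ) {t : ℕ}
    (h : History A t) : Prop :=
  n₀ ≤ visits V h ∧ √(L / (2 * n₀)) < |freq V y h - μ|

/-- Too few of the rounds of type `E` have an observation in `G`. -/
def Few (E : ℕ → A → Prop) (G : Obs K N → Prop) (q L : ℝ) {t : ℕ} (h : History A t) : Prop :=
  visits (fun ℓ e => E ℓ e.2 ∧ G e.1) h < q / 2 * visits (fun ℓ e => E ℓ e.2) h - L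

/-- Too many of the rounds of type `E` have an observation in `G`. -/
def Many (E : ℕ → A → Prop) (G : Obs K N → Prop) (q L : ℝ) {t : ℕ} (h : History A t) : Prop :=
  2 * q * visits (fun ℓ e => E ℓ e.2) h + L < visits (fun ℓ e => E ℓ e.2 ∧ G e.1) h

open Classical in
/-- Hoeffding's inequality for the frequency of `y` in at least `n₀` rounds. -/
theorem histProbOf_deviates_le {t : ℕ} {V : ℕ → Obs K N × A → Prop} {y : Obs K N → Bool} {μ n₀ L : ℝ}
    (hμ : μ ∈ Set.Icc (0 : ℝ) 1) (hn₀ : 0 < n₀) (hL : 0 ≤ L)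
    (hV : ∀ ℓ (a : A),
      ∑ o, θ.prob a o * (if V ℓ (o, a) then (if y o then 1 else 0) - μ else 0) = 0) :
    φ.histProbOf θ t (Deviates V y μ n₀ L) ≤
      2 * Real.exp (-L) := by
  -- The optimal parameter for exactly `n₀` samples: the gain `c √(L / (2 n₀))` is twice the cost `c
  -- ^ 2 / 8 = L / n₀`.
  set c : ℝ := √(8 * L / n₀) with hc
  have hc2 : c ^ 2 / 8 = L / n₀ := by
    rw [hc, Real.sq_sqrt (by positivity)]; ring
  have hcs : c * √(L / (2 * n₀)) = 2 * (L / n₀) := by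
    rw [hc, ← Real.sqrt_mul (by positivity)]
    have : 8 * L / n₀ * (L / (2 * n₀)) = (2 * (L / n₀)) ^ 2 := by field_simp; ring
    rw [this, Real.sqrt_sq (by positivity)]
  have h1 (c : ℝ) := histProbOf_le_exp (φ := φ) (θ := θ) (t := t)
    (g := fun ℓ e => if V ℓ e then c * ((if y e.1 then 1 else 0) - μ) - c ^ 2 / 8 else 0)
    (fun ℓ a => sum_prob_exp_le hμ (hV ℓ a) c) L
  rw [two_mul (Real.exp _)]
  refine (histProbOf_mono fun h hh => ?_).trans (histProbOf_or_le (h1 c) (h1 (-c)))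
  obtain ⟨hC, hdev⟩ := hh
  have hC0 : 0 < visits V h := hn₀.trans_le hC
  rw [sum_sub_eq_freq _ _ _ _ hC0, sum_sub_eq_freq _ _ _ _ hC0, neg_sq, hc2]
  -- The net gain per visit is at least `L / n₀`, so more than `n₀` visits only help, and no union
  -- over the number of visits is needed.
  have key (x : ℝ) (hx : √(L / (2 * n₀)) ≤ x) : L ≤ (c * x - L / n₀) * visits V h := by
    have : L / n₀ ≤ c * x - L / n₀ := by
      have := mul_le_mul_of_nonneg_left hx (Real.sqrt_nonneg (8 * L / n₀))
      rw [← hc, hcs] at this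
      linarith
    calc L = L / n₀ * n₀ := by field_simp
      _ ≤ _ := mul_le_mul this hC hn₀.le ((by positivity : 0 ≤ L / n₀).trans this)
  rcases lt_abs.1 hdev with h' | h'
  · exact Or.inl (key _ h'.le)
  · right
    rw [neg_mul_comm]
    exact key _ h'.le

/-- Lower tail of the number of the rounds of type `E` with an observation in `G`. -/
theorem histProbOf_few_le {t : ℕ} {E : ℕ → A → Prop} {G : Obs K N → Prop} [DecidablePred G] {q : ℝ}
    (hq : ∀ ℓ (a : A), E ℓ a → ∑ o, θ.prob a o * (if G o then 1 else 0) = q) (L : ℝ) :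
    φ.histProbOf θ t (Few E G q L) ≤ Real.exp (-L) := by
  classical
  have he : Real.exp (-1) ≤ 1 / 2 := by
    rw [Real.exp_neg, ← one_div]
    exact one_div_le_one_div_of_le (by norm_num) (by linarith [Real.add_one_le_exp (1 : ℝ)])
  have h1 := histProbOf_le_exp (φ := φ) (θ := θ) (t := t)
    (g := fun ℓ e => if E ℓ e.2 then q / 2 - (if G e.1 then 1 else 0) else 0)
    (fun ℓ a => by
      by_cases hE : E ℓ a
      · simp only [hE, if_true]
        -- With `G` read as its indicator, `exp (-G) ≤ 1 - G / 2` because `exp (-1) ≤ 1 / 2`; its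
        -- mean `1 - q / 2` is at most `exp (-q / 2)`.
        have hpt (o : Obs K N) : Real.exp (q / 2 - (if G o then 1 else 0)) ≤
            Real.exp (q / 2) * (1 - (if G o then 1 else 0) / 2) := by
          rw [sub_eq_add_neg, Real.exp_add]
          refine mul_le_mul_of_nonneg_left ?_ (Real.exp_pos _).le
          by_cases hG : G o <;> simp only [hG, if_true, if_false]
          · linarith
          · simp
        calc _ ≤ ∑ o, θ.prob a o * (Real.exp (q / 2) * (1 - (if G o then 1 else 0) / 2)) :=
              Finset.sum_le_sum fun o _ => mul_le_mul_of_nonneg_left (hpt o) (θ.prob_nonneg a o)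
          _ = Real.exp (q / 2) *
                (∑ o, θ.prob a o - (∑ o, θ.prob a o * (if G o then 1 else 0)) / 2) := by
              rw [Finset.sum_div, ← Finset.sum_sub_distrib, Finset.mul_sum]
              exact Finset.sum_congr rfl fun o _ => by ring
          _ ≤ Real.exp (q / 2) * Real.exp (-(q / 2)) := by
              rw [hq ℓ a hE, θ.sum_prob]
              exact mul_le_mul_of_nonneg_left (by linarith [Real.add_one_le_exp (-(q / 2))])
                (Real.exp_pos _).le
          _ = 1 := by rw [← Real.exp_add]; simp
      · simp [hE, θ.sum_prob]) L
  refine (histProbOf_mono fun h hh => ?_).trans h1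
  have : ∑ ℓ : Fin t, (if E ℓ (h ℓ).2 then q / 2 - (if G (h ℓ).1 then 1 else 0) else 0) =
      q / 2 * visits (fun ℓ e => E ℓ e.2) h - visits (fun ℓ e => E ℓ e.2 ∧ G e.1) h := by
    rw [visits, visits, Finset.mul_sum, ← Finset.sum_sub_distrib]
    refine Finset.sum_congr rfl fun ℓ _ => ?_
    by_cases hE : E ℓ (h ℓ).2 <;> simp [hE]
  rw [Few] at hh
  rw [this]
  linarith

/-- Upper tail of the number of the rounds of type `E` with an observation in `G`. -/
theorem histProbOf_many_le {t : ℕ} {E : ℕ → A → Prop} {G : Obs K N → Prop} [DecidablePred G] {q : ℝ}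
    (hq : ∀ ℓ (a : A), E ℓ a → ∑ o, θ.prob a o * (if G o then 1 else 0) = q) (L : ℝ) :
    φ.histProbOf θ t (Many E G q L) ≤ Real.exp (-L) := by
  classical
  have he : Real.exp 1 ≤ 3 := by linarith [Real.exp_one_lt_d9]
  have h1 := histProbOf_le_exp (φ := φ) (θ := θ) (t := t)
    (g := fun ℓ e => if E ℓ e.2 then -(2 * q) + (if G e.1 then 1 else 0) else 0)
    (fun ℓ a => by
      by_cases hE : E ℓ a
      · simp only [hE, if_true]
        -- Here `exp G ≤ 1 + 2 G` because `e ≤ 3`; the mean `1 + 2 q` is at most `exp (2 q)`.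
        have hpt (o : Obs K N) : Real.exp (-(2 * q) + (if G o then 1 else 0)) ≤
            Real.exp (-(2 * q)) * (1 + 2 * (if G o then 1 else 0)) := by
          rw [Real.exp_add]
          refine mul_le_mul_of_nonneg_left ?_ (Real.exp_pos _).le
          by_cases hG : G o <;> simp only [hG, if_true, if_false]
          · linarith
          · simp
        calc _ ≤ ∑ o, θ.prob a o * (Real.exp (-(2 * q)) * (1 + 2 * (if G o then 1 else 0))) :=
              Finset.sum_le_sum fun o _ => mul_le_mul_of_nonneg_left (hpt o) (θ.prob_nonneg a o)
          _ = Real.exp (-(2 * q)) *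
                (∑ o, θ.prob a o + 2 * ∑ o, θ.prob a o * (if G o then 1 else 0)) := by
              rw [Finset.mul_sum, ← Finset.sum_add_distrib, Finset.mul_sum]
              exact Finset.sum_congr rfl fun o _ => by ring
          _ ≤ Real.exp (-(2 * q)) * Real.exp (2 * q) := by
              rw [hq ℓ a hE, θ.sum_prob]
              exact mul_le_mul_of_nonneg_left (by linarith [Real.add_one_le_exp (2 * q)])
                (Real.exp_pos _).le
          _ = 1 := by rw [← Real.exp_add]; simp
      · simp [hE, θ.sum_prob]) L
  refine (histProbOf_mono fun h hh => ?_).trans h1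
  have : ∑ ℓ : Fin t, (if E ℓ (h ℓ).2 then -(2 * q) + (if G (h ℓ).1 then 1 else 0) else 0) =
      visits (fun ℓ e => E ℓ e.2 ∧ G e.1) h - 2 * q * visits (fun ℓ e => E ℓ e.2) h := by
    rw [visits, visits, Finset.mul_sum, ← Finset.sum_sub_distrib]
    refine Finset.sum_congr rfl fun ℓ _ => ?_
    by_cases hE : E ℓ (h ℓ).2 <;> simp only [hE, if_true, if_false, true_and, false_and] <;> ring
  rw [Many] at hh
  rw [this]
  linarith

end Algorithm

namespace Model

variable {K N : ℕ} (θ : Model K N)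

theorem sum_prob_arm_context_arm (i : Fin K) (n : Fin N) (x : Bool) :
    ∑ o : Obs K N, θ.prob (.arm n x) o * (if o.1 = i ∧ o.2.1 n = x then 1 else 0) = θ.α i := by
  have := θ.sum_prob_mul (.arm n x) fun s z => if z n = x then if s = i then 1 else 0 else 0
  have h2 (o : Obs K N) : (if o.1 = i ∧ o.2.1 n = x then (1 : ℝ) else 0) =
      if o.2.1 n = x then if o.1 = i then 1 else 0 else 0 := by
    by_cases h : o.1 = i <;> by_cases h' : o.2.1 n = x <;> simp [h, h']
  simp only [h2, this, θ.sum_arm_restrict, ← Finset.sum_mul, sum_prod_probX, probS]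
  simp

end Model

/-! ### Deterministic algorithms and their regret. -/

namespace Algorithm

variable {K N : ℕ} {A : Finset (Intervention K N)}

/-- The algorithm which follows a deterministic rule. -/
def ofRule (R : (t : ℕ) → History A t → A) : Algorithm A where
  rule t h _ := R t h
  measurable_rule _ _ _ := MeasurableSet.const _

section ofRule

variable (R : (t : ℕ) → History A t → A) (θ : Model K N)

theorem select_ofRule (t : ℕ) (h : History A t) (a : A) :
    (ofRule R).select t h a = if R t h = a then 1 else 0 := by
  simp only [select, ofRule]
  split_ifs with h' <;> simp [h']

variable {R θ}

/-- Selection probabilities are `0` or `1`, so only histories that follow the rule carry mass. -/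
theorem eq_rule_of_histProb_ne_zero {t : ℕ} {h : History A t}
    (hh : (ofRule R).histProb θ t h ≠ 0) (ℓ : Fin t) :
    (h ℓ).2 = R ℓ fun j : Fin ℓ => h (Fin.castLE ℓ.isLt.le j) := by
  have := left_ne_zero_of_mul (Finset.prod_ne_zero_iff.1 hh ℓ (Finset.mem_univ _))
  rw [select_ofRule] at this
  by_contra hne
  exact this (if_neg fun h' => hne h'.symm)

theorem regret_ofRule (t : ℕ) : (ofRule R).regret θ t =
    ∑ h, (ofRule R).histProb θ t h * ((⨆ a : A, θ.mean a) - θ.mean (R t h)) := by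
  simp only [mul_sub, Finset.sum_sub_distrib, ← Finset.sum_mul, sum_histProb, one_mul]
  rw [regret]
  congr 1
  simp only [recommend, Finset.mul_sum]
  rw [Finset.sum_comm]
  refine Finset.sum_congr rfl fun h _ => ?_
  simp only [select_ofRule]
  rw [Finset.sum_eq_single (R t h)]
  · simp; ring
  · intro a _ ha
    simp [ha.symm]
  · simp

/-- The regret is controlled by the gap on a typical history and the probability of the others. -/
theorem regret_ofRule_le {t : ℕ} {P : History A t → Prop} {ε δ : ℝ} (hε : 0 ≤ ε)
    (hP : (ofRule R).histProbOf θ t P ≤ δ)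
    (hgap : ∀ h, (ofRule R).histProb θ t h ≠ 0 → ¬ P h → ∀ a : A,
      θ.mean a ≤ θ.mean (R t h) + ε) :
    (ofRule R).regret θ t ≤ ε + δ := by
  classical
  rw [regret_ofRule]
  calc _ ≤ ∑ h, (ofRule R).histProb θ t h * (ε + if P h then 1 else 0) := by
        refine Finset.sum_le_sum fun h _ => ?_
        by_cases h0 : (ofRule R).histProb θ t h = 0
        · simp [h0]
        refine mul_le_mul_of_nonneg_left ?_ (histProb_nonneg _ θ t h)
        have : Nonempty A := ⟨R t h⟩
        rw [sub_le_iff_le_add]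
        refine ciSup_le fun a => ?_
        by_cases hPh : P h
        · have h1 := (θ.mean_mem a).2
          have h2 := (θ.mean_mem (R t h)).1
          simp only [hPh, if_true]
          linarith
        · have := hgap h h0 hPh a
          simp only [hPh, if_false]
          linarith
    _ = ε + (ofRule R).histProbOf θ t P := by
        simp only [mul_add, Finset.sum_add_distrib, ← Finset.sum_mul, sum_histProb, one_mul]
        rfl
    _ ≤ _ := by linarith

end ofRule

/-! ### Statistics that depend only on an initial segment of the history. -/

section prefixes

theorem sum_prefix {t T : ℕ} (ht : t ≤ T) (h : History A T) (F : ℕ → Obs K N × A → ℝ)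
    (hF : ∀ ℓ e, t ≤ ℓ → F ℓ e = 0) :
    ∑ ℓ : Fin T, F ℓ (h ℓ) = ∑ ℓ : Fin t, F ℓ (h (Fin.castLE ht ℓ)) := by
  obtain ⟨k, rfl⟩ := Nat.exists_eq_add_of_le ht
  rw [Fin.sum_univ_add]
  have : ∑ j : Fin k, F (Fin.natAdd t j) (h (Fin.natAdd t j)) = 0 :=
    Finset.sum_eq_zero fun j _ => hF _ _ (by simp)
  rw [this, add_zero]
  rfl

variable {V : ℕ → Obs K N × A → Prop}

theorem visits_prefix {t T : ℕ} (ht : t ≤ T) (h : History A T)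
    (hV : ∀ ℓ e, V ℓ e → ℓ < t) :
    visits V (fun ℓ : Fin t => h (Fin.castLE ht ℓ)) = visits V h := by
  classical
  exact (sum_prefix ht h (fun ℓ e => if V ℓ e then 1 else 0)
    fun ℓ e hℓ => if_neg fun hv => absurd (hV ℓ e hv) hℓ.not_gt).symm

theorem freq_prefix {t T : ℕ} (ht : t ≤ T) (h : History A T) (y : Obs K N → Bool)
    (hV : ∀ ℓ e, V ℓ e → ℓ < t) :
    freq V y (fun ℓ : Fin t => h (Fin.castLE ht ℓ)) = freq V y h := by
  classical
  rw [freq, freq, visits_prefix ht h hV]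
  congr 1
  exact (sum_prefix ht h (fun ℓ e => if V ℓ e then (if y e.1 then 1 else 0) else 0)
    fun ℓ e hℓ => if_neg fun hv => absurd (hV ℓ e hv) hℓ.not_gt).symm

theorem visits_le {t : ℕ} (h : History A t) : visits V h ≤ t := by
  classical
  calc _ ≤ ∑ _ℓ : Fin t, (1 : ℝ) := Finset.sum_le_sum fun ℓ _ => by split_ifs <;> norm_num
    _ = t := by simp

theorem freq_eq_div {t : ℕ} (y : Obs K N → Bool) (h : History A t) :
    freq V y h = visits (fun ℓ e => V ℓ e ∧ y e.1) h / visits V h := by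
  rw [freq]
  congr 1
  rw [visits]
  refine Finset.sum_congr rfl fun ℓ _ => ?_
  by_cases hv : V ℓ (h ℓ) <;> simp [hv]

theorem visits_and_add {t : ℕ} (y : Obs K N → Bool) (h : History A t) :
    visits (fun ℓ e => V ℓ e ∧ y e.1 = true) h + visits (fun ℓ e => V ℓ e ∧ y e.1 = false) h =
      visits V h := by
  rw [visits, visits, visits, ← Finset.sum_add_distrib]
  refine Finset.sum_congr rfl fun ℓ _ => ?_
  by_cases hv : V ℓ (h ℓ) <;> cases y (h ℓ).1 <;> simp [hv]

end prefixes

/-! ### The strategy and guaranteed numbers of plays. -/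

section strategy

/-- The first half of the rounds, in which the algorithm only observes. -/
def initial (T ℓ : ℕ) (e : Obs K N × A) : Prop := ℓ < T / 2 ∧ (e.2 : Intervention K N) = .empty

/-- The rounds in which the reward has the mean `armMean i n x`. -/
def informative (i : Fin K) (n : Fin N) (x : Bool) (_ : ℕ) (e : Obs K N × A) : Prop :=
  ((e.2 : Intervention K N) = .empty ∨ (e.2 : Intervention K N) = .arm n x) ∧
    e.1.1 = i ∧ e.1.2.1 n = x

/-- The empirical version of `Model.p`. -/
noncomputable def pHat (T : ℕ) {t : ℕ} (h : History A t) (i : Fin K) (n : Fin N) : ℝ :=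
  freq (fun ℓ e => initial T ℓ e ∧ e.1.1 = i) (fun o => o.2.1 n) h

/-- The arm values which are rarely observed in the context `i`. -/
noncomputable def rare (T : ℕ) {t : ℕ} (h : History A t) (i : Fin K) : Finset (Fin N × Bool) :=
  biased (pHat T h i) (m (pHat T h i)) ×ˢ Finset.univ

/-- The action of a round: observe in the first half of the rounds, then cycle through the
contexts and their rare arm values, and in the last quarter set the context. -/
noncomputable def schedule [NeZero K] (T : ℕ) {t : ℕ} (h : History A t) : Intervention K N :=
  if t < T / 2 then .empty
  else if t < T / 2 + T / 4 then
    -- If no arm value is rare, the list is empty, the lookup returns `none`, and the round is spent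
    -- on `do(∅)`.
    ((rare T h (Fin.ofNat K (t - T / 2))).toList[(t - T / 2) / K %
      (rare T h (Fin.ofNat K (t - T / 2))).card]?).elim .empty fun e => .arm e.1 e.2
  else .context (Fin.ofNat K (t - (T / 2 + T / 4)))

/-- The empirical version of `Model.mean`. -/
noncomputable def meanHat (T : ℕ) {t : ℕ} (h : History A t) : Intervention K N → ℝ
  | .empty => freq (initial T) (fun o => o.2.2) h
  | .arm n x => ∑ i, freq (initial T) (fun o => decide (o.1 = i)) h *
      freq (informative i n x) (fun o => o.2.2) h
  | .context s => freq (fun _ e => (e.2 : Intervention K N) = .context s) (fun o => o.2.2) h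

/-- The rare sets use only the observing phase, so they stay fixed while the schedule cycles through
them. -/
theorem rare_prefix {t T : ℕ} {h : History A T} (ht : t ≤ T) (ht' : T / 2 ≤ t) (i : Fin K) :
    rare T (fun j : Fin t => h (Fin.castLE ht j)) i = rare T h i := by
  have : pHat T (fun j : Fin t => h (Fin.castLE ht j)) i = pHat T h i := by
    funext n
    exact freq_prefix ht h _ fun ℓ e he => he.1.1.trans_le ht'
  rw [rare, rare, this]

theorem exists_best (hA : Intervention.empty ∈ A) (T : ℕ) {t : ℕ} (h : History A t) :
    ∃ b : A, ∀ a : A, meanHat T h a ≤ meanHat T h b :=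
  have : Nonempty A := ⟨⟨_, hA⟩⟩
  Finite.exists_max fun a : A => meanHat T h a

open Classical in
/-- Follow the schedule for `T` rounds, replacing unavailable actions by `do(∅)`, and then
recommend the action with the highest estimate. -/
noncomputable def strategy [NeZero K] (hA : Intervention.empty ∈ A) (T t : ℕ) (h : History A t) :
    A :=
  if T ≤ t then (exists_best hA T h).choose
  else if ha : schedule T h ∈ A then ⟨schedule T h, ha⟩ else ⟨.empty, hA⟩

variable [NeZero K] {hA : Intervention.empty ∈ A} {θ : Model K N} {T : ℕ} {h : History A T}

theorem meanHat_le_strategy (a : A) : meanHat T h a ≤ meanHat T h (strategy hA T T h) := by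
  rw [strategy, if_pos le_rfl]
  exact (exists_best hA T h).choose_spec a

/-- The actions of a history `h` are those of the strategy. -/
def Consistent (hA : Intervention.empty ∈ A) (h : History A T) : Prop :=
  ∀ ℓ : Fin T, (h ℓ).2 = strategy hA T ℓ fun j : Fin ℓ => h (Fin.castLE ℓ.isLt.le j)

theorem Consistent.action_eq (hc : Consistent hA h) {ℓ : Fin T} {a : Intervention K N}
    (ha : a ∈ A) (hs : schedule T (fun j : Fin ℓ => h (Fin.castLE ℓ.isLt.le j)) = a) :
    ((h ℓ).2 : Intervention K N) = a := by
  rw [hc ℓ, strategy, if_neg ℓ.isLt.not_ge, dif_pos (hs ▸ ha)]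
  exact hs

theorem Consistent.initial_of_lt (hc : Consistent hA h) (ℓ : Fin T) (hℓ : (ℓ : ℕ) < T / 2) :
    initial T ℓ (h ℓ) :=
  ⟨hℓ, hc.action_eq hA (by rw [schedule, if_pos hℓ])⟩

theorem visits_initial (hc : Consistent hA h) : visits (initial T) h = (T / 2 : ℕ) := by
  apply le_antisymm
  · rw [← visits_prefix (Nat.div_le_self T 2) h fun ℓ e he => he.1]
    exact visits_le _
  · exact card_le_visits id (Set.injOn_id _) (fun l hl => hl.trans_le (Nat.div_le_self T 2))
      fun l hl hl' => hc.initial_of_lt ⟨l, hl'⟩ hl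

theorem le_visits_context (hc : Consistent hA h) {s : Fin K} (hs : Intervention.context s ∈ A) :
    (((T - (T / 2 + T / 4)) / K : ℕ) : ℝ) ≤
      visits (fun _ e => (e.2 : Intervention K N) = .context s) h := by
  have hK : 0 < K := Nat.pos_of_neZero K
  refine card_le_visits (fun l => T / 2 + T / 4 + (s + K * l)) ?_ ?_ ?_
  · intro l _ l' _ hl
    have : K * l = K * l' := by simpa using hl
    exact Nat.eq_of_mul_eq_mul_left hK this
  · intro l hl
    have h1 : K * (l + 1) ≤ T - (T / 2 + T / 4) :=
      (Nat.mul_le_mul_left K hl).trans (Nat.mul_div_le _ _)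
    have := s.isLt
    rw [mul_add] at h1
    omega
  · intro l _ hl
    refine hc.action_eq hs ?_
    rw [schedule, if_neg (by simp only; omega), if_neg (by simp only; omega)]
    congr 1
    apply Fin.ext
    simp [Nat.mod_eq_of_lt s.isLt]

theorem le_visits_arm (hc : Consistent hA h) {i : Fin K} {n : Fin N} {x : Bool}
    (hnx : Intervention.arm n x ∈ A) (hr : (n, x) ∈ rare T h i) :
    ((T / 4 / (K * (rare T h i).card) : ℕ) : ℝ) ≤
      visits (fun _ e => (e.2 : Intervention K N) = .arm n x) h := by
  have hK : 0 < K := Nat.pos_of_neZero K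
  obtain ⟨k, hk, hkx⟩ := List.mem_iff_getElem.1 (Finset.mem_toList.2 hr)
  rw [Finset.length_toList] at hk
  set M := (rare T h i).card with hM
  have hrange (l : ℕ) (hl : l < T / 4 / (K * M)) : (i : ℕ) + K * (k + M * l) < T / 4 := by
    have h1 : K * M * (l + 1) ≤ T / 4 := (Nat.mul_le_mul_left _ hl).trans (Nat.mul_div_le _ _)
    have h2 : K * (k + 1) ≤ K * M := Nat.mul_le_mul_left K hk
    have := i.isLt
    nlinarith
  -- In the second phase the remainder mod `K` selects the context and the quotient mod `M` the list
  -- position; `k` is the position of `(n, x)`.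
  refine card_le_visits (fun l => T / 2 + (i + K * (k + M * l))) ?_ ?_ ?_
  · intro l _ l' _ hl
    have : K * (k + M * l) = K * (k + M * l') := by simpa using hl
    have := Nat.eq_of_mul_eq_mul_left hK this
    exact Nat.eq_of_mul_eq_mul_left (by omega : 0 < M) (by omega)
  · intro l hl
    have := hrange l hl
    omega
  · intro l hl hlT
    have := hrange l hl
    refine hc.action_eq hnx ?_
    rw [schedule, if_neg (by simp only; omega), if_pos (by simp only; omega)]
    have hsub : T / 2 + (i + K * (k + M * l)) - T / 2 = i + K * (k + M * l) := by omega
    have hi : Fin.ofNat K (i + K * (k + M * l)) = i := by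
      apply Fin.ext
      simp [Nat.mod_eq_of_lt i.isLt]
    have hdiv : (i + K * (k + M * l)) / K = k + M * l := by
      rw [Nat.add_mul_div_left _ _ hK, Nat.div_eq_of_lt i.isLt, zero_add]
    simp only [hsub, hi, hdiv]
    rw [rare_prefix _ (by simp), ← hM, Nat.add_mul_mod_self_left, Nat.mod_eq_of_lt hk,
      List.getElem?_eq_getElem (by rwa [Finset.length_toList]), hkx]
    rfl

end strategy

end Algorithm

/-! ### The complexity `m`, the horizon condition and the sum over contexts. -/

theorem one_le_m {N : ℕ} (hN : 1 ≤ N) (v : Fin N → ℝ) : 1 ≤ m v := by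
  obtain ⟨h0, hs⟩ := (m_isLeast hN v).1
  by_contra! h
  -- A threshold above `1` makes all `N ≥ 1` entries biased, which contradicts `m v < 1`.
  have h1 : 1 < 1 / m v := by rw [lt_div_iff₀ h0]; linarith
  have : biased v (m v) = Finset.univ := by
    refine Finset.filter_true_of_mem fun n _ => ?_
    rcases le_total (v n) 1 with hv | hv
    · exact (min_le_left _ _).trans_lt (by linarith)
    · exact (min_le_right _ _).trans_lt (by linarith)
  rw [this, Finset.card_univ, Fintype.card_fin] at hs
  have : (1 : ℝ) ≤ N := by exact_mod_cast hN
  linarith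

namespace Model

variable {K N T : ℕ} {θ : Model K N}

theorem LargeHorizon.le (hθ : θ.LargeHorizon T) (hN : 1 ≤ N) (hL : 0 ≤ Real.log ((N : ℝ) * T))
    (i : Fin K) : 4200 * K * m (θ.p i) * Real.log ((N : ℝ) * T) ≤ θ.α i * T := by
  have hm := one_le_m hN (θ.p i)
  have hα := θ.α_pos i
  have h1 : m (θ.p i) / θ.α i ≤ ⨆ j, m (θ.p j) / θ.α j :=
    le_ciSup (f := fun j => m (θ.p j) / θ.α j) (Set.finite_range _).bddAbove i
  have h2 : 4200 * (K : ℝ) * (m (θ.p i) / θ.α i) * Real.log ((N : ℝ) * T) ≤ T := by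
    refine le_trans ?_ (le_of_lt hθ)
    have hq : 0 ≤ m (θ.p i) / θ.α i := by positivity
    gcongr ?_ * ?_ * _
    · linarith
  calc _ = θ.α i * (4200 * (K : ℝ) * (m (θ.p i) / θ.α i) * Real.log ((N : ℝ) * T)) := by
        field_simp
    _ ≤ _ := mul_le_mul_of_nonneg_left h2 hα.le

theorem one_le_mAvg (hN : 1 ≤ N) : 1 ≤ θ.mAvg := by
  rw [← θ.α_sum, mAvg]
  exact Finset.sum_le_sum fun i _ =>
    le_mul_of_one_le_right (θ.α_pos i).le (one_le_m hN _)

theorem α_le_one (i : Fin K) : θ.α i ≤ 1 := by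
  rw [← θ.α_sum]
  exact Finset.single_le_sum (fun j _ => (θ.α_pos j).le) (Finset.mem_univ i)

/-- Each term is `√(B K) √(αᵢ m(pᵢ))`; Cauchy–Schwarz over the `K` contexts supplies the second
factor `√K`. -/
theorem sum_mul_sqrt_le (hN : 1 ≤ N) {B : ℝ} (hB : 0 ≤ B) :
    ∑ i, θ.α i * √(B * (K * m (θ.p i)) / θ.α i) ≤ K * √(B * θ.mAvg) := by
  have h1 (i : Fin K) : θ.α i * √(B * (K * m (θ.p i)) / θ.α i) =
      √(B * K) * (√1 * √(θ.α i * m (θ.p i))) := by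
    have hα := θ.α_pos i
    have hm := one_le_m hN (θ.p i)
    conv_lhs => rw [← Real.sqrt_sq hα.le]
    rw [Real.sqrt_one, one_mul, ← Real.sqrt_mul (by positivity), ← Real.sqrt_mul (by positivity)]
    congr 1
    rw [Real.sqrt_sq hα.le]
    field_simp
  rw [Finset.sum_congr rfl fun i _ => h1 i, ← Finset.mul_sum]
  have h2 := Real.sum_sqrt_mul_sqrt_le (Finset.univ : Finset (Fin K)) (f := fun _ => 1)
    (g := fun i => θ.α i * m (θ.p i)) (fun _ => zero_le_one)
    (fun i => mul_nonneg (θ.α_pos i).le (zero_le_one.trans (one_le_m hN _)))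
  refine (mul_le_mul_of_nonneg_left h2 (Real.sqrt_nonneg _)).trans_eq ?_
  have hK : (0 : ℝ) ≤ K := Nat.cast_nonneg K
  have hm : (0 : ℝ) ≤ θ.mAvg := zero_le_one.trans (one_le_mAvg hN)
  simp only [Finset.sum_const, Finset.card_univ, Fintype.card_fin, nsmul_eq_mul, mul_one]
  change √(B * K) * (√K * √θ.mAvg) = _
  rw [Real.sqrt_mul hB, Real.sqrt_mul hB]
  calc _ = (√K * √K) * (√B * √θ.mAvg) := by ring
    _ = _ := by rw [Real.mul_self_sqrt hK]

end Model

/-! ### Atypical histories and the union bound. -/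

namespace Algorithm

variable {K N : ℕ} {A : Finset (Intervention K N)} {θ : Model K N} {φ : Algorithm A}

theorem histProbOf_deviates_of_action_le {T : ℕ} {b : Intervention K N} {E : ℕ → A → Prop}
    {y : Obs K N → Bool} {μ n₀ L : ℝ} (hμ : μ ∈ Set.Icc (0 : ℝ) 1) (hn₀ : 0 < n₀) (hL : 0 ≤ L)
    (hE : ∀ ℓ a, E ℓ a → a = b)
    (h : ∑ o, θ.prob b o * ((if y o then 1 else 0) - μ) = 0) :
    φ.histProbOf θ T (Deviates (fun ℓ e => E ℓ e.2) y μ n₀ L) ≤ 2 * Real.exp (-L) := by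
  refine histProbOf_deviates_le hμ hn₀ hL fun ℓ a => ?_
  by_cases ha : E ℓ a
  · obtain rfl := hE ℓ a ha
    simpa only [ha, if_true] using h
  · simp [ha]

open Classical in
theorem sum_prob_informative (i : Fin K) (n : Fin N) (x : Bool) (ℓ : ℕ) (a : A) :
    ∑ o, θ.prob a o * (if informative i n x ℓ (o, a) then
      (if o.2.2 then 1 else 0) - θ.armMean i n x else 0) = 0 := by
  by_cases ha : (a : Intervention K N) = .empty ∨ (a : Intervention K N) = .arm n x
  · refine (Finset.sum_congr rfl fun o _ => ?_).trans (θ.sum_prob_sub_armMean ha i)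
    simp only [informative, ha, true_and]
  · simp [informative, ha]

/-- The action `a` is played in the initial rounds. -/
def initialAction (T ℓ : ℕ) (a : A) : Prop := ℓ < T / 2 ∧ (a : Intervention K N) = .empty

/-- The history `h` is atypical: one of the frequencies or counts is far from its mean. -/
def Atypical (θ : Model K N) (T : ℕ) (L n₁ : ℝ) (n₀ : Fin K → ℝ) (h : History A T) : Prop :=
  (∃ k : Fin K × Fin N × Bool, Deviates (informative k.1 k.2.1 k.2.2) (fun o => o.2.2)
    (θ.armMean k.1 k.2.1 k.2.2) (n₀ k.1) L h) ∨
  (∃ k : Fin K × Fin N × Bool, Few (initialAction T) (fun o => o.1 = k.1 ∧ o.2.1 k.2.1 = k.2.2)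
    (θ.α k.1 * bern (θ.p k.1 k.2.1) k.2.2) L h) ∨
  (∃ k : Fin K × Fin N × Bool, Few (fun _ a => (a : Intervention K N) = .arm k.2.1 k.2.2)
    (fun o => o.1 = k.1 ∧ o.2.1 k.2.1 = k.2.2) (θ.α k.1) L h) ∨
  (∃ i, Few (initialAction T) (fun o => o.1 = i) (θ.α i) L h) ∨
  (∃ i, Many (initialAction T) (fun o => o.1 = i) (θ.α i) L h) ∨
  (∃ i, Deviates (initial T) (fun o => decide (o.1 = i)) (θ.α i) (T / 2 : ℕ) L h) ∨
  Deviates (initial T) (fun o => o.2.2) (θ.mean .empty) (T / 2 : ℕ) L h ∨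
  (∃ s, Deviates (fun _ e => (e.2 : Intervention K N) = .context s) (fun o => o.2.2)
    (θ.mean (.context s)) n₁ L h)

section events

variable {T : ℕ} {L : ℝ}

theorem histProbOf_deviates_informative_le {n₀ : Fin K → ℝ} (hn₀ : ∀ i, 0 < n₀ i) (hL : 0 ≤ L) :
    φ.histProbOf θ T (fun h => ∃ k : Fin K × Fin N × Bool,
      Deviates (informative k.1 k.2.1 k.2.2) (fun o => o.2.2)
        (θ.armMean k.1 k.2.1 k.2.2) (n₀ k.1) L h) ≤
      Fintype.card (Fin K × Fin N × Bool) * (2 * Real.exp (-L)) :=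
  histProbOf_exists_le fun k => histProbOf_deviates_le (θ.armMean_mem k.1 k.2.1 k.2.2)
    (hn₀ k.1) hL (sum_prob_informative k.1 k.2.1 k.2.2)

theorem histProbOf_few_context_arm_le :
    φ.histProbOf θ T (fun h => ∃ k : Fin K × Fin N × Bool,
      Few (initialAction T) (fun o => o.1 = k.1 ∧ o.2.1 k.2.1 = k.2.2)
        (θ.α k.1 * bern (θ.p k.1 k.2.1) k.2.2) L h) ≤
      Fintype.card (Fin K × Fin N × Bool) * Real.exp (-L) :=
  histProbOf_exists_le fun k => histProbOf_few_le
    (fun ℓ a ha => by rw [ha.2]; exact θ.sum_prob_context_arm k.1 k.2.1 k.2.2) L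

theorem histProbOf_few_arm_le :
    φ.histProbOf θ T (fun h => ∃ k : Fin K × Fin N × Bool,
      Few (fun _ a => (a : Intervention K N) = .arm k.2.1 k.2.2)
        (fun o => o.1 = k.1 ∧ o.2.1 k.2.1 = k.2.2) (θ.α k.1) L h) ≤
      Fintype.card (Fin K × Fin N × Bool) * Real.exp (-L) :=
  histProbOf_exists_le fun k => histProbOf_few_le
    (fun ℓ a ha => by rw [ha]; exact θ.sum_prob_arm_context_arm k.1 k.2.1 k.2.2) L

theorem sum_prob_initialAction (i : Fin K) (ℓ : ℕ) (a : A) (ha : initialAction T ℓ a) :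
    ∑ o, θ.prob a o * (if o.1 = i then 1 else 0) = θ.α i := by
  rw [ha.2]
  exact θ.sum_prob_context .empty i

theorem histProbOf_few_context_le :
    φ.histProbOf θ T (fun h => ∃ i, Few (initialAction T) (fun o => o.1 = i) (θ.α i) L h) ≤
      Fintype.card (Fin K) * Real.exp (-L) :=
  histProbOf_exists_le fun i => histProbOf_few_le (sum_prob_initialAction i) L

theorem histProbOf_many_context_le :
    φ.histProbOf θ T (fun h => ∃ i, Many (initialAction T) (fun o => o.1 = i) (θ.α i) L h) ≤
      Fintype.card (Fin K) * Real.exp (-L) :=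
  histProbOf_exists_le fun i => histProbOf_many_le (sum_prob_initialAction i) L

theorem histProbOf_deviates_context_le (hT : 2 ≤ T) (hL : 0 ≤ L) :
    φ.histProbOf θ T (fun h => ∃ i, Deviates (initial T) (fun o => decide (o.1 = i)) (θ.α i)
      (T / 2 : ℕ) L h) ≤ Fintype.card (Fin K) * (2 * Real.exp (-L)) := by
  refine histProbOf_exists_le fun i => ?_
  refine histProbOf_deviates_of_action_le (E := initialAction T) (b := .empty)
    ⟨(θ.α_pos i).le, θ.α_le_one i⟩ (by exact_mod_cast (by omega : 0 < T / 2)) hL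
    (fun _ _ ha => ha.2) ?_
  simpa only [Model.probS, decide_eq_true_eq] using θ.sum_prob_context_sub .empty i

theorem histProbOf_deviates_empty_le (hT : 2 ≤ T) (hL : 0 ≤ L) :
    φ.histProbOf θ T (Deviates (initial T) (fun o => o.2.2) (θ.mean .empty) (T / 2 : ℕ) L) ≤
      2 * Real.exp (-L) :=
  histProbOf_deviates_of_action_le (E := initialAction T) (b := .empty) (θ.mean_mem .empty)
    (by exact_mod_cast (by omega : 0 < T / 2)) hL (fun _ _ ha => ha.2)
    (θ.sum_prob_sub_mean .empty)

theorem histProbOf_deviates_set_context_le {n₁ : ℝ} (hn₁ : 0 < n₁) (hL : 0 ≤ L) :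
    φ.histProbOf θ T (fun h => ∃ s,
      Deviates (fun _ e => (e.2 : Intervention K N) = .context s) (fun o => o.2.2)
        (θ.mean (.context s)) n₁ L h) ≤ Fintype.card (Fin K) * (2 * Real.exp (-L)) :=
  histProbOf_exists_le fun s => histProbOf_deviates_of_action_le (b := .context s)
    (E := fun _ (a : A) => (a : Intervention K N) = .context s) (y := fun o => o.2.2)
    (θ.mean_mem (.context s)) hn₁ hL (fun _ _ ha => ha) (θ.sum_prob_sub_mean (.context s))

theorem histProbOf_atypical_le {n₁ : ℝ} {n₀ : Fin K → ℝ}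
    (hK : 1 ≤ K) (hN : 1 ≤ N) (hT : 2 ≤ T) (hL : 0 ≤ L) (hn₁ : 0 < n₁) (hn₀ : ∀ i, 0 < n₀ i) :
    φ.histProbOf θ T (Atypical θ T L n₁ n₀) ≤ 16 * (K * N) * Real.exp (-L) := by
  refine le_trans (histProbOf_or_le (histProbOf_deviates_informative_le hn₀ hL) <|
    histProbOf_or_le histProbOf_few_context_arm_le <| histProbOf_or_le histProbOf_few_arm_le <|
    histProbOf_or_le histProbOf_few_context_le <| histProbOf_or_le histProbOf_many_context_le <|
    histProbOf_or_le (histProbOf_deviates_context_le hT hL) <|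
    histProbOf_or_le (histProbOf_deviates_empty_le hT hL) <|
    histProbOf_deviates_set_context_le hn₁ hL) ?_
  have hK' : (1 : ℝ) ≤ K := by exact_mod_cast hK
  have hN' : (1 : ℝ) ≤ N := by exact_mod_cast hN
  simp only [Fintype.card_prod, Fintype.card_fin, Fintype.card_bool]
  push_cast
  -- The three families over `Fin K × Fin N × Bool` cost `2 K N (2 + 1 + 1)`, the four over contexts
  -- `K (1 + 1 + 2 + 2)`, and the single event `2`.
  have : 8 * (K * N) + 6 * K + 2 ≤ 16 * ((K : ℝ) * N) := by nlinarith
  refine le_trans (le_of_eq ?_) (mul_le_mul_of_nonneg_right this (Real.exp_pos (-L)).le)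
  ring

end events

end Algorithm

/-! ### Estimates on typical histories. -/

theorem m_le {N : ℕ} {v : Fin N → ℝ} {s : ℝ} (h0 : 0 < s) (hs : ((biased v s).card : ℝ) ≤ s) :
    m v ≤ s :=
  csInf_le ⟨0, fun _ h => h.1.le⟩ ⟨h0, hs⟩

theorem notMem_biased_iff {N : ℕ} {v : Fin N → ℝ} {s : ℝ} {n : Fin N} :
    n ∉ biased v s ↔ ∀ x, 1 / s ≤ bern (v n) x := by
  simp [biased, bern, and_comm]

/-- A lower bound for the number of informative rounds on typical histories. -/
noncomputable def Model.minVisits {K N : ℕ} (θ : Model K N) (T : ℕ) (i : Fin K) : ℝ :=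
  θ.α i * T / (100 * (K * m (θ.p i)))

namespace Algorithm

variable {K N : ℕ} {A : Finset (Intervention K N)} {θ : Model K N} {T : ℕ} {L n₁ : ℝ}

section pHat

variable {t : ℕ} (h : History A t) (i : Fin K) (n : Fin N)

theorem bern_pHat_mul (x : Bool) (h0 : 0 < visits (fun ℓ e => initial T ℓ e ∧ e.1.1 = i) h) :
    bern (pHat T h i n) x * visits (fun ℓ e => initial T ℓ e ∧ e.1.1 = i) h =
      visits (fun ℓ e => (initial T ℓ e ∧ e.1.1 = i) ∧ e.1.2.1 n = x) h := by
  have h1 := visits_and_add (V := fun ℓ e => initial T ℓ e ∧ e.1.1 = i) (fun o => o.2.1 n) h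
  have h2 : pHat T h i n * visits (fun ℓ e => initial T ℓ e ∧ e.1.1 = i) h =
      visits (fun ℓ e => (initial T ℓ e ∧ e.1.1 = i) ∧ e.1.2.1 n = true) h := by
    rw [pHat, freq_eq_div, div_mul_cancel₀ _ h0.ne']
  cases x
  · simp only [bern, Bool.false_eq_true, if_false, sub_mul, one_mul, h2]
    linarith
  · simpa only [bern, if_true] using h2

end pHat

namespace Consistent

variable {n₀ : Fin K → ℝ} [NeZero K] {hA : Intervention.empty ∈ A} {h : History A T}
  (hc : Consistent hA h) (ht : ¬ Atypical θ T L n₁ n₀ h)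
include hc ht

theorem le_visits_context_arm (i : Fin K) (n : Fin N) (x : Bool) :
    θ.α i * bern (θ.p i n) x / 2 * (T / 2 : ℕ) - L ≤
      visits (fun ℓ e => (initial T ℓ e ∧ e.1.1 = i) ∧ e.1.2.1 n = x) h := by
  simp only [Atypical, not_or, not_exists] at ht
  have := not_lt.1 (ht.2.1 (i, n, x))
  rw [show visits (fun ℓ e => initialAction T ℓ e.2) h = _ from visits_initial hc] at this
  exact this.trans (visits_mono fun ℓ hℓ => ⟨⟨hℓ.1, hℓ.2.1⟩, hℓ.2.2⟩)

theorem visits_context_mem (i : Fin K) :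
    visits (fun ℓ e => initial T ℓ e ∧ e.1.1 = i) h ∈
      Set.Icc (θ.α i / 2 * (T / 2 : ℕ) - L) (2 * θ.α i * (T / 2 : ℕ) + L) := by
  simp only [Atypical, not_or, not_exists] at ht
  have h1 := not_lt.1 (ht.2.2.2.1 i)
  have h2 := not_lt.1 (ht.2.2.2.2.1 i)
  rw [show visits (fun ℓ e => initialAction T ℓ e.2) h = _ from visits_initial hc] at h1 h2
  exact ⟨h1, h2⟩

theorem abs_context_le (i : Fin K) :
    |freq (initial T) (fun o => decide (o.1 = i)) h - θ.α i| ≤ √(L / (2 * (T / 2 : ℕ))) := by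
  simp only [Atypical, not_or, not_exists, Deviates, not_and, not_lt] at ht
  exact ht.2.2.2.2.2.1 i (visits_initial hc).ge

theorem abs_meanHat_empty_le :
    |meanHat T h .empty - θ.mean .empty| ≤ √(L / (2 * (T / 2 : ℕ))) := by
  simp only [Atypical, not_or, not_exists, Deviates, not_and, not_lt] at ht
  exact ht.2.2.2.2.2.2.1 (visits_initial hc).ge

end Consistent

/-- The conditions on the horizon which the analysis uses. -/
structure Long (θ : Model K N) (T : ℕ) (L : ℝ) : Prop where
  one_le_card : 1 ≤ K
  one_le_arms : 1 ≤ N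
  le_log : 69 / 100 ≤ L
  le_horizon : ∀ i, 4200 * (K * m (θ.p i)) * L ≤ θ.α i * T

namespace Long

variable (hT : Long θ T L)
include hT

theorem one_le_mul (i : Fin K) : 1 ≤ K * m (θ.p i) := by
  have h1 : (1 : ℝ) ≤ K := by exact_mod_cast hT.one_le_card
  nlinarith [one_le_m hT.one_le_arms (θ.p i)]

theorem le_T : 2800 * (K : ℝ) ≤ T := by
  have hK := hT.one_le_card
  let i : Fin K := ⟨0, hK⟩
  have h1 : (1 : ℝ) ≤ K := by exact_mod_cast hK
  have h2 := one_le_m hT.one_le_arms (θ.p i)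
  have h3 := hT.le_horizon i
  have h4 := hT.le_log
  have h5 : θ.α i * T ≤ T := mul_le_of_le_one_left (Nat.cast_nonneg T) (θ.α_le_one i)
  have h6 : (K : ℝ) ≤ K * m (θ.p i) := le_mul_of_one_le_right (by linarith) h2
  have h7 : (K : ℝ) * (69 / 100) ≤ K * m (θ.p i) * L :=
    mul_le_mul h6 h4 (by norm_num) (by linarith)
  linarith

theorem half_ge : (2 / 5 : ℝ) * T ≤ (T / 2 : ℕ) := by
  have h1 : (1 : ℝ) ≤ K := by exact_mod_cast hT.one_le_card
  have h2 : (T : ℝ) ≤ 2 * (T / 2 : ℕ) + 1 := by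
    exact_mod_cast (by omega : T ≤ 2 * (T / 2) + 1)
  linarith [hT.le_T]

theorem minVisits_pos (i : Fin K) : 0 < θ.minVisits T i := by
  have h1 := hT.one_le_mul i
  have h2 := hT.le_T
  have h3 : (1 : ℝ) ≤ K := by exact_mod_cast hT.one_le_card
  have h4 := θ.α_pos i
  have : (0 : ℝ) < T := by linarith
  unfold Model.minVisits
  positivity

variable [NeZero K] {hA : Intervention.empty ∈ A} {h : History A T}
  (hc : Consistent hA h) (ht : ¬ Atypical θ T L n₁ (θ.minVisits T) h)
include hc ht

theorem le_visits_context_initial (i : Fin K) :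
    1 / 10 * (θ.α i * T) ≤ visits (fun ℓ e => initial T ℓ e ∧ e.1.1 = i) h := by
  have h1 := (hc.visits_context_mem ht i).1
  have h2 := hT.le_horizon i
  have h3 := hT.one_le_mul i
  have h4 := hT.le_log
  have h5 := mul_le_mul_of_nonneg_left hT.half_ge (θ.α_pos i).le
  nlinarith

/-- An arm value of probability at least `1 / m` keeps empirical frequency at least `1 / (5 m)`: the
counts in numerator and denominator are each off by a factor at most `2`, up to `L`, and `5 > 4`
absorbs the terms in `L`. So `5 m` is admissible in the infimum defining `m` of the empirical
vector. -/
theorem m_pHat_le (i : Fin K) : m (pHat T h i) ≤ 5 * m (θ.p i) := by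
  have hm := one_le_m hT.one_le_arms (θ.p i)
  have hα := θ.α_pos i
  have hN := hT.le_visits_context_initial hc ht i
  have hN' := (hc.visits_context_mem ht i).2
  have hH := hT.le_horizon i
  have hL := hT.le_log
  have hK : (1 : ℝ) ≤ K := by exact_mod_cast hT.one_le_card
  have hT2 := mul_le_mul_of_nonneg_left hT.half_ge (θ.α_pos i).le
  have hmL : 4200 * (m (θ.p i) * L) ≤ θ.α i * T := by
    refine le_trans ?_ hH
    have : 0 ≤ m (θ.p i) * L := by positivity
    nlinarith
  have hTpos : 0 < θ.α i * T := lt_of_lt_of_le (by positivity) hmL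
  have hsub : biased (pHat T h i) (5 * m (θ.p i)) ⊆ biased (θ.p i) (m (θ.p i)) := by
    intro n
    contrapose!
    rw [notMem_biased_iff, notMem_biased_iff]
    intro hn x
    have h1 := hc.le_visits_context_arm ht i n x
    rw [← bern_pHat_mul h i n x (by linarith)] at h1
    have h2 : θ.α i / m (θ.p i) / 2 * (T / 2 : ℕ) - L ≤
        θ.α i * bern (θ.p i n) x / 2 * (T / 2 : ℕ) - L := by
      have := hn x
      rw [div_eq_mul_one_div (θ.α i)]
      gcongr
    refine le_of_mul_le_mul_right (le_trans ?_ (h2.trans h1)) (by linarith)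
    rw [one_div_mul_eq_div, div_le_iff₀ (by positivity)]
    have : (θ.α i / m (θ.p i) / 2 * (T / 2 : ℕ) - L) * (5 * m (θ.p i)) =
        5 / 2 * (θ.α i * (T / 2 : ℕ)) - 5 * (m (θ.p i) * L) := by
      field_simp
    rw [this]
    have : L ≤ m (θ.p i) * L := le_mul_of_one_le_left (by linarith) hm
    linarith
  refine m_le (by linarith) ?_
  have h1 : ((biased (pHat T h i) (5 * m (θ.p i))).card : ℝ) ≤ (biased (θ.p i) (m (θ.p i))).card :=
    by exact_mod_cast Finset.card_le_card hsub
  have h2 := (m_isLeast hT.one_le_arms (θ.p i)).1.2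
  linarith

theorem minVisits_le (hnmc : ∀ n x, Intervention.arm n x ∈ A) (i : Fin K) (n : Fin N) (x : Bool) :
    θ.minVisits T i ≤ visits (informative i n x) h := by
  have hm := one_le_m hT.one_le_arms (θ.p i)
  have hα := θ.α_pos i
  have hH := hT.le_horizon i
  have hL := hT.le_log
  have hK : (1 : ℝ) ≤ K := by exact_mod_cast hT.one_le_card
  have hm' := one_le_m hT.one_le_arms (pHat T h i)
  have hmle := hT.m_pHat_le hc ht i
  have hKm := hT.one_le_mul i
  have hT0 := hT.le_T
  have hTpos : (0 : ℝ) < T := by linarith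
  -- Rare values get their informative rounds from the second phase, all others from passive
  -- observation.
  by_cases hr : (n, x) ∈ rare T h i
  · have hR := le_visits_arm hc (hnmc n x) hr
    have ht' := ht
    simp only [Atypical, not_or, not_exists] at ht'
    have h3 := not_lt.1 (ht'.2.2.1 (i, n, x))
    refine le_trans ?_ (h3.trans (visits_mono fun ℓ hℓ => ⟨Or.inr hℓ.1, hℓ.2⟩))
    have hcard : ((rare T h i).card : ℝ) ≤ 10 * m (θ.p i) := by
      have := (m_isLeast hT.one_le_arms (pHat T h i)).1.2
      rw [rare, Finset.card_product]
      push_cast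
      simp
      linarith
    have hpos : 0 < (rare T h i).card := Finset.card_pos.2 ⟨_, hr⟩
    set M := (rare T h i).card
    set R := T / 4 / (K * M)
    have h4 : T / 4 < K * M * (R + 1) :=
      Nat.lt_mul_div_succ _ (Nat.mul_pos hT.one_le_card hpos)
    have h5 : (T : ℝ) ≤ 4 * (K * M * (R + 1)) := by
      exact_mod_cast (by omega : T ≤ 4 * (K * M * (R + 1)))
    have h6 : (T : ℝ) ≤ 40 * (K * m (θ.p i)) * (R + 1) := by
      refine h5.trans ?_
      have : (K : ℝ) * M ≤ K * (10 * m (θ.p i)) := by gcongr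
      have hR0 : (0 : ℝ) ≤ R + 1 := by positivity
      nlinarith
    have h7 : θ.α i / 2 * R - L ≤ θ.α i / 2 *
        visits (fun _ e => (e.2 : Intervention K N) = .arm n x) h - L := by gcongr
    refine le_trans ?_ h7
    -- The main term is `αᵢ T / (80 K m)`; the gap between `80` and `100` pays for the rounding `αᵢ
    -- / 2` and for `L`.
    rw [Model.minVisits, div_le_iff₀ (by positivity)]
    have h8 := mul_le_mul_of_nonneg_left h6 hα.le
    have h9 : θ.α i * (K * m (θ.p i)) ≤ 2 * (K * m (θ.p i) * L) := by
      have := θ.α_le_one i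
      have : θ.α i ≤ 2 * L := by linarith
      nlinarith
    nlinarith
  · have hn : n ∉ biased (pHat T h i) (m (pHat T h i)) := by
      simpa [rare] using hr
    have hN := hT.le_visits_context_initial hc ht i
    have hαT : 0 < θ.α i * T := by positivity
    have h1 := mul_le_mul_of_nonneg_right (notMem_biased_iff.1 hn x)
      (visits_nonneg (fun ℓ e => initial T ℓ e ∧ e.1.1 = i) h)
    rw [bern_pHat_mul h i n x (by linarith)] at h1
    refine le_trans ?_ (h1.trans (visits_mono fun ℓ hℓ => ⟨Or.inl hℓ.1.1.2, hℓ.1.2, hℓ.2⟩))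
    calc θ.minVisits T i ≤ 1 / (5 * m (θ.p i)) * (1 / 10 * (θ.α i * T)) := by
          rw [Model.minVisits, div_le_iff₀ (by positivity)]
          field_simp
          linarith
      _ ≤ _ := by gcongr

theorem abs_informative_le (hnmc : ∀ n x, Intervention.arm n x ∈ A) (i : Fin K) (n : Fin N)
    (x : Bool) : |freq (informative i n x) (fun o => o.2.2) h - θ.armMean i n x| ≤
      √(L / (2 * θ.minVisits T i)) := by
  have hv := hT.minVisits_le hc ht hnmc i n x
  simp only [Atypical, not_or, not_exists, Deviates, not_and, not_lt] at ht
  exact ht.1 (i, n, x) hv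

theorem abs_meanHat_context_le (hn₁ : n₁ = T / (6 * K)) {s : Fin K}
    (hs : Intervention.context s ∈ A) :
    |meanHat T h (.context s) - θ.mean (.context s)| ≤ √(L / (2 * n₁)) := by
  have h1 := le_visits_context hc hs
  simp only [Atypical, not_or, not_exists, Deviates, not_and, not_lt] at ht
  refine ht.2.2.2.2.2.2.2 s (le_trans ?_ h1)
  have hK : (1 : ℝ) ≤ K := by exact_mod_cast hT.one_le_card
  have h2 := Nat.lt_mul_div_succ (T - (T / 2 + T / 4)) hT.one_le_card
  set R := (T - (T / 2 + T / 4)) / K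
  -- The last phase has at least `T / 4` rounds; passing from `T / (4 K) - 1` to `T / (6 K)` uses
  -- that `T` is large compared with `K`.
  have h3 : (T : ℝ) ≤ 4 * (K * (R + 1)) := by
    exact_mod_cast (by omega : T ≤ 4 * (K * (R + 1)))
  have := hT.le_T
  rw [hn₁, div_le_iff₀ (by positivity)]
  nlinarith

theorem abs_meanHat_arm_le (hnmc : ∀ n x, Intervention.arm n x ∈ A) (n : Fin N) (x : Bool) :
    |meanHat T h (.arm n x) - θ.mean (.arm n x)| ≤
      K * √(L / (2 * (T / 2 : ℕ))) + ∑ i, θ.α i * √(L / (2 * θ.minVisits T i)) := by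
  rw [θ.mean_arm, meanHat, ← Finset.sum_sub_distrib]
  refine (Finset.abs_sum_le_sum_abs _ _).trans ?_
  have : (K : ℝ) * √(L / (2 * (T / 2 : ℕ))) = ∑ _i : Fin K, √(L / (2 * (T / 2 : ℕ))) := by simp
  rw [this, ← Finset.sum_add_distrib]
  refine Finset.sum_le_sum fun i _ => ?_
  have h1 := hc.abs_context_le ht i
  have h2 := hT.abs_informative_le hc ht hnmc i n x
  obtain ⟨f0, f1⟩ := freq_mem (informative i n x) (fun o => o.2.2) h
  set a := freq (initial T) (fun o => decide (o.1 = i)) h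
  set f := freq (informative i n x) (fun o => o.2.2) h
  -- The reward error is weighted by the true `αᵢ`, which compensates the `αᵢ` in the denominator of
  -- its bound; the error of `a` only meets `f ≤ 1`.
  calc _ = |(a - θ.α i) * f + θ.α i * (f - θ.armMean i n x)| := by congr 1; ring
    _ ≤ |a - θ.α i| * f + θ.α i * |f - θ.armMean i n x| := by
        refine (abs_add_le _ _).trans_eq ?_
        rw [abs_mul, abs_mul, abs_of_nonneg f0, abs_of_pos (θ.α_pos i)]
    _ ≤ _ := add_le_add ((mul_le_of_le_one_right (abs_nonneg _) f1).trans h1)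
        (mul_le_mul_of_nonneg_left h2 (θ.α_pos i).le)

end Long

end Algorithm

/-! ### Collecting constants into the regret bound. -/

namespace Algorithm

variable {K N : ℕ} {A : Finset (Intervention K N)} {θ : Model K N} {T : ℕ} {L : ℝ}

namespace Long

variable (hT : Long θ T L)
include hT

theorem sqrt_half_le : √(L / (2 * (T / 2 : ℕ))) ≤ 5 / 4 * √(θ.mAvg * L / T) := by
  have h0 := hT.half_ge
  have h1 : (1 : ℝ) ≤ K := by exact_mod_cast hT.one_le_card
  have hTpos : (0 : ℝ) < T := by linarith [hT.le_T]
  have hL := hT.le_log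
  have hm : 1 ≤ θ.mAvg := Model.one_le_mAvg hT.one_le_arms
  rw [show (5 / 4 : ℝ) = √((5 / 4) ^ 2) by rw [Real.sqrt_sq (by norm_num)],
    ← Real.sqrt_mul (by positivity)]
  apply Real.sqrt_le_sqrt
  calc L / (2 * (T / 2 : ℕ)) ≤ L / (2 * (2 / 5 * T)) := by gcongr
    _ = 5 / 4 * (1 * L / T) := by field_simp; norm_num
    _ ≤ (5 / 4) ^ 2 * (θ.mAvg * L / T) := by gcongr; norm_num

theorem sum_sqrt_minVisits_le :
    ∑ i, θ.α i * √(L / (2 * θ.minVisits T i)) ≤ 71 / 10 * (K * √(θ.mAvg * L / T)) := by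
  have h1 : (1 : ℝ) ≤ K := by exact_mod_cast hT.one_le_card
  have hTpos : (0 : ℝ) < T := by linarith [hT.le_T]
  have hL := hT.le_log
  have h2 (i : Fin K) : L / (2 * θ.minVisits T i) = 50 * L / T * (K * m (θ.p i)) / θ.α i := by
    have := θ.α_pos i
    have := hT.one_le_mul i
    have hm := one_le_m hT.one_le_arms (θ.p i)
    rw [Model.minVisits]
    field_simp
    norm_num
  simp only [h2]
  refine (Model.sum_mul_sqrt_le hT.one_le_arms (by positivity)).trans ?_
  have h3 : 50 * L / T * θ.mAvg = 50 * (θ.mAvg * L / T) := by ring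
  have h4 : √50 ≤ (71 / 10 : ℝ) := Real.sqrt_le_iff.2 ⟨by norm_num, by norm_num⟩
  rw [h3, Real.sqrt_mul (by norm_num)]
  have := mul_le_mul_of_nonneg_right h4
    (mul_nonneg (zero_le_one.trans h1) (Real.sqrt_nonneg (θ.mAvg * L / T)))
  linarith

theorem sqrt_context_le :
    √(L / (2 * (T / (6 * K)))) ≤ 2 * (K * √(θ.mAvg * L / T)) := by
  have h1 : (1 : ℝ) ≤ K := by exact_mod_cast hT.one_le_card
  have hTpos : (0 : ℝ) < T := by linarith [hT.le_T]
  have hL := hT.le_log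
  have hm : 1 ≤ θ.mAvg := Model.one_le_mAvg hT.one_le_arms
  rw [← mul_assoc, show (2 * K : ℝ) = √((2 * K) ^ 2) by rw [Real.sqrt_sq (by positivity)],
    ← Real.sqrt_mul (by positivity)]
  apply Real.sqrt_le_sqrt
  calc L / (2 * (T / (6 * K))) = 3 * K * (1 * L / T) := by field_simp; norm_num
    _ ≤ (2 * K) ^ 2 * (θ.mAvg * L / T) := by
        gcongr
        nlinarith

theorem failure_le : 16 * (K : ℝ) / T ≤ 1 / 2 * (K * √(θ.mAvg * L / T)) := by
  have h1 : (1 : ℝ) ≤ K := by exact_mod_cast hT.one_le_card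
  have hT0 : (2800 : ℝ) ≤ T := by linarith [hT.le_T]
  have hL := hT.le_log
  have hm : 1 ≤ θ.mAvg := Model.one_le_mAvg hT.one_le_arms
  have h2 : 32 / (T : ℝ) ≤ √(θ.mAvg * L / T) := by
    apply Real.le_sqrt_of_sq_le
    rw [div_pow, div_le_div_iff₀ (by positivity) (by linarith)]
    have : 69 / 100 ≤ θ.mAvg * L := by nlinarith
    nlinarith
  calc 16 * (K : ℝ) / T = 1 / 2 * (K * (32 / T)) := by ring
    _ ≤ _ := by gcongr

variable [NeZero K] {hA : Intervention.empty ∈ A} {h : History A T}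
  (hc : Consistent hA h) (ht : ¬ Atypical θ T L (T / (6 * K)) (θ.minVisits T) h)
include hc ht

/-- The worst case is `do(X_n = x)`, with `5 / 4 + 71 / 10 ≤ 17 / 2`. -/
theorem abs_meanHat_sub_le (hnmc : ∀ n x, Intervention.arm n x ∈ A) {a : Intervention K N}
    (ha : a ∈ A) : |meanHat T h a - θ.mean a| ≤ 17 / 2 * (K * √(θ.mAvg * L / T)) := by
  have h1 : (1 : ℝ) ≤ K := by exact_mod_cast hT.one_le_card
  have hQ := Real.sqrt_nonneg (θ.mAvg * L / T)
  have hKQ := le_mul_of_one_le_left hQ h1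
  have h2 := hT.sqrt_half_le
  cases a with
  | empty => linarith [hc.abs_meanHat_empty_le ht]
  | arm n x =>
    have h3 := mul_le_mul_of_nonneg_left h2 (zero_le_one.trans h1)
    linarith [hT.abs_meanHat_arm_le hc ht hnmc n x, hT.sum_sqrt_minVisits_le]
  | context s => linarith [hT.abs_meanHat_context_le hc ht rfl ha, hT.sqrt_context_le]

end Long

/-- The regret of the strategy, for each of the two sets of actions. -/
theorem regret_strategy_le [NeZero K] (hN : 1 ≤ N) (hT : 2 ≤ T) (hA : Intervention.empty ∈ A)
    (hnmc : ∀ n x, Intervention.arm n x ∈ A) (hθ : θ.LargeHorizon T) :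
    (ofRule (strategy hA T)).regret θ T ≤
      7 * √((K : ℝ) * (7 * K + 1) * θ.mAvg * Real.log ((N : ℝ) * T) / T) := by
  have hK : 1 ≤ K := Nat.pos_of_neZero K
  have hNT : (2 : ℝ) ≤ N * T := by
    exact_mod_cast (by nlinarith : 2 ≤ N * T)
  set L := Real.log ((N : ℝ) * T) with hLdef
  have hL : 69 / 100 ≤ L := by
    have := Real.log_le_log (by norm_num) hNT
    linarith [Real.log_two_gt_d9]
  have hlong : Long θ T L :=
    ⟨hK, hN, hL, fun i => by simpa only [mul_assoc] using hθ.le hN (by linarith) i⟩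
  have h1 : (1 : ℝ) ≤ K := by exact_mod_cast hK
  have hTpos : (0 : ℝ) < T := by linarith [hlong.le_T]
  have hN' : (1 : ℝ) ≤ N := by exact_mod_cast hN
  have hm : 1 ≤ θ.mAvg := Model.one_le_mAvg hN
  set Z := K * √(θ.mAvg * L / T) with hZ
  have hZ0 : 0 ≤ Z := by positivity
  have hexp : 16 * (K * N) * Real.exp (-L) = 16 * (K : ℝ) / T := by
    rw [Real.exp_neg, hLdef, Real.exp_log (by linarith)]
    field_simp
  -- Maximizing estimates that are each off by at most `17 / 2 * Z` loses at most twice that.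
  have hreg : (ofRule (strategy hA T)).regret θ T ≤ 17 * Z + 16 * (K : ℝ) / T := by
    refine regret_ofRule_le (by positivity)
      ((histProbOf_atypical_le hK hN hT (by linarith) (n₁ := T / (6 * K)) (by positivity)
        hlong.minVisits_pos).trans_eq hexp) fun h hh ht a => ?_
    have hc : Consistent hA h := fun ℓ => eq_rule_of_histProb_ne_zero hh ℓ
    have ha := abs_le.1 (hlong.abs_meanHat_sub_le hc ht hnmc a.2)
    have hb := abs_le.1 (hlong.abs_meanHat_sub_le hc ht hnmc (strategy hA T T h).2)
    have := meanHat_le_strategy (hA := hA) (h := h) a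
    linarith [ha.1, hb.2]
  -- The total is `17 + 1 / 2 = 7 * (5 / 2)` times `Z`, and `(5 / 2 * K) ^ 2 ≤ K (7 K + 1)`.
  have hfin : 5 / 2 * Z ≤ √((K : ℝ) * (7 * K + 1) * θ.mAvg * L / T) := by
    rw [hZ, ← mul_assoc, show (5 / 2 * K : ℝ) = √((5 / 2 * K) ^ 2) by
      rw [Real.sqrt_sq (by positivity)], ← Real.sqrt_mul (by positivity)]
    apply Real.sqrt_le_sqrt
    have : (K : ℝ) * (7 * K + 1) * θ.mAvg * L / T = K * (7 * K + 1) * (θ.mAvg * L / T) := by ring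
    rw [this]
    gcongr
    nlinarith
  linarith [hlong.failure_le]

end Algorithm

theorem empty_mem_nmcActions {K N : ℕ} : Intervention.empty ∈ nmcActions K N := by
  simp [nmcActions]

theorem arm_mem_nmcActions {K N : ℕ} (n : Fin N) (x : Bool) :
    Intervention.arm n x ∈ nmcActions K N := by
  simp [nmcActions]

end HCB

theorem theorem3 (K N T : ℕ) (hK : 1 ≤ K) (hN : 1 ≤ N) (hT : 2 ≤ T) :
    (∃ φ : HCB.Algorithm (HCB.nmcActions K N), ∀ θ : HCB.Model K N, θ.LargeHorizon T →
      φ.regret θ T ≤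
        27 * √((K : ℝ) * (2 * K + 1) * θ.mAvg * Real.log ((N : ℝ) * T) / T)) ∧
    (∃ φ : HCB.Algorithm (HCB.mcActions K N), ∀ θ : HCB.Model K N, θ.LargeHorizon T →
      φ.regret θ T ≤
        7 * √((K : ℝ) * (7 * K + 1) * θ.mAvg * Real.log ((N : ℝ) * T) / T)) := by
  have : NeZero K := ⟨by omega⟩
  refine ⟨⟨.ofRule (HCB.Algorithm.strategy HCB.empty_mem_nmcActions T), fun θ hθ => ?_⟩,
    ⟨.ofRule (HCB.Algorithm.strategy (Finset.mem_union_left _ HCB.empty_mem_nmcActions) T), fun θ hθ =>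
      HCB.Algorithm.regret_strategy_le hN hT _
        (fun n x => Finset.mem_union_left _ (HCB.arm_mem_nmcActions n x)) hθ⟩⟩
  -- The bound with constant `7` also holds without manipulable context, and it is the stronger one:
  -- `49 (7 K + 1) ≤ 729 (2 K + 1)`.
  refine (HCB.Algorithm.regret_strategy_le hN hT _ HCB.arm_mem_nmcActions hθ).trans ?_
  have hlog : 0 ≤ Real.log ((N : ℝ) * T) := by
    rw [← Nat.cast_mul]
    exact Real.log_natCast_nonneg _
  have hm : 1 ≤ θ.mAvg := HCB.Model.one_le_mAvg hN
  rw [show (7 : ℝ) = √(7 ^ 2) by rw [Real.sqrt_sq (by norm_num)],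
    show (27 : ℝ) = √(27 ^ 2) by rw [Real.sqrt_sq (by norm_num)],
    ← Real.sqrt_mul (by positivity), ← Real.sqrt_mul (by positivity)]
  apply Real.sqrt_le_sqrt
  have hq : 0 ≤ K * (θ.mAvg * Real.log ((N : ℝ) * T) / T) := by positivity
  have hK0 : (0 : ℝ) ≤ K := Nat.cast_nonneg K
  calc _ = (343 * K + 49) * (K * (θ.mAvg * Real.log ((N : ℝ) * T) / T)) := by ring
    _ ≤ (1458 * K + 729) * (K * (θ.mAvg * Real.log ((N : ℝ) * T) / T)) := by
        gcongr <;> norm_num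
    _ = _ := by ring
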